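/- Let $A_\star\in\mathbb{R}^{n\times n}$, $B_\star\in\mathbb{R}^{n\times d}$ with $1\le d\le n$, and let $Q\in\mathbb{R}^{n\times n}$, $R\in\mathbb{R}^{d\times d}$ be (symmetric) positive definite with $\underline\sigma(R)\ge 1$. Here $\|\cdot\|$ is the spectral norm, $\underline\sigma(M)=\sqrt{\lambda_{\min}(MM^\top)}$, $\rho(M)$ is the spectral radius, and $\tau(M,\rho)=\sup_{k\ge 0}\|M^k\|\rho^{-k}\in[1,\infty]$ is the smallest value with $\|M^k\|\le\tau(M,\rho)\rho^k$ for all $k\ge 0$. For a pair $(A,B)$ let $\mathsf{dare}(A,B,Q,R)$ be the unique positive semidefinite solution $P$ of $$P=A^\top PA-A^\top PB(R+B^\top PB)^{-1}B^\top PA+Q ,$$ whenever it exists, with the corresponding controller $K=-(R+B^\top PB)^{-1}B^\top PA$. Write $P_\star,K_\star$ for these at $(A_\star,B_\star)$ and $\widehat P,\widehat K$ for these at estimates $(\widehat A,\widehat B)$. Let $L_\star=A_\star+B_\star K_\star$ and $\Gamma_\star=1+\max\{\|A_\star\|,\|B_\star\|,\|P_\star\|,\|K_\star\|\}$. For a matrix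 $K$ let $$J(A_\star,B_\star,K)=\lim_{T\to\infty}\mathbb{E}\Big[\frac1T\sum_{t=0}^T x_t^\top Qx_t+u_t^\top Ru_t\Big],\qquad x_{t+1}=A_\star x_t+B_\star u_t+w_t,\quad u_t=Kx_t,$$ with $x_0\sim\mathcal N(0,I_n)$ and $w_t\sim\mathcal N(0,\sigma_w^2I_n)$, all independent, and put $\widehat J=J(A_\star,B_\star,\widehat K)$, $J_\star=J(A_\star,B_\star,K_\star)$. Assume that $(A_\star,B_\star)$ is $(\ell,\nu)$-controllable for some integer $\ell\ge1$ and some $\nu>0$, that is, $\underline\sigma([\,B_\star\ \ A_\star B_\star\ \cdots\ A_\star^{\ell-1}B_\star\,])\ge\nu$. Then $P_\star$ exists and is unique. Let $\rho\ge\rho(A_\star)$ and $\rho(L_\star)\le\gamma<1$, let $\varepsilon>0$ be such that $\|\widehat A-A_\star\|\le\varepsilon$ and $\|\widehat B-B_\star\|\le\varepsilon$, and put $\beta=\max\{1,\varepsilon\,\tau(A_\star,\rho)+\rho\}$. There is a universal constant $C>0$, independent of all the data above, such that $$\widehat J-J_\star\le C\,\sigma_w^2\,d\,\ell^5\,\Gamma_\star^{15}\,\tau(A_\star,\rho)^6\,\beta^{4(\ell-1)}\,\frac{\tau(L_\star,\gamma)^2}{1-\gamma^2}\,\frac{\max\{\|Q\|^2,\|R\|^2\}}{\min\{\underline\sigma(Q)^2,\underline\sigma(R)^2\}}\Big(1+\frac1\nu\Big)^2\varepsilon^2$$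 as long as the right-hand side is (finite and) smaller than $\sigma_w^2$; in that case $\widehat P$ exists and is unique, and the limits defining $\widehat J$ and $J_\star$ exist and are finite. -/

import Mathlib

open Filter Topology MeasureTheory ProbabilityTheory
open scoped ENNReal Matrix Matrix.Norms.L2Operator

noncomputable section

namespace LQR

/- Throughout, `‖M‖` of a real matrix is its spectral (operator) norm, by the scope
`Matrix.Norms.L2Operator`. -/

/-- The smallest singular value `σ_min(M) = sqrt (λ_min (M Mᵀ))` of a matrix with `n` rows
(the `n`-th singular value). -/
def sigmaMin {n : ℕ} {κ : Type} [Fintype κ] (M : Matrix (Fin n) κ ℝ) : ℝ :=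
  Real.sqrt (⨅ i, (Matrix.isHermitian_mul_conjTranspose_self M).eigenvalues i)

/-- The spectral radius of a real square matrix: the largest modulus of a complex eigenvalue. -/
def specRadius {n : ℕ} (M : Matrix (Fin n) (Fin n) ℝ) : ℝ :=
  (spectralRadius ℂ (M.map (algebraMap ℝ ℂ))).toReal

/-- `τ(M, ρ) = sup_k ‖M^k‖ ρ^(-k)`, the smallest value with `‖M^k‖ ≤ τ(M, ρ) ρ^k` for all `k`;
it may be infinite. -/
def transient {n : ℕ} (M : Matrix (Fin n) (Fin n) ℝ) (ρ : ℝ) : ℝ≥0∞ :=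
  ⨆ k : ℕ, ENNReal.ofReal ‖M ^ k‖ / ENNReal.ofReal ρ ^ k

/-- The block matrix `[B, A B, …, A^(ℓ-1) B]`. -/
def ctrbMatrix {n d : ℕ} (A : Matrix (Fin n) (Fin n) ℝ) (B : Matrix (Fin n) (Fin d) ℝ) (ℓ : ℕ) :
    Matrix (Fin n) (Fin ℓ × Fin d) ℝ :=
  Matrix.of fun i p => (A ^ (p.1 : ℕ) * B) i p.2

/-- `(A, B)` is `(ℓ, ν)`-controllable. -/
def IsControllable {n d : ℕ} (A : Matrix (Fin n) (Fin n) ℝ) (B : Matrix (Fin n) (Fin d) ℝ)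
    (ℓ : ℕ) (ν : ℝ) : Prop :=
  ν ≤ sigmaMin (ctrbMatrix A B ℓ)

/-- `P` is a positive semidefinite solution of the discrete algebraic Riccati equation. -/
def IsDareSolution {n d : ℕ} (A : Matrix (Fin n) (Fin n) ℝ) (B : Matrix (Fin n) (Fin d) ℝ)
    (Q : Matrix (Fin n) (Fin n) ℝ) (R : Matrix (Fin d) (Fin d) ℝ)
    (P : Matrix (Fin n) (Fin n) ℝ) : Prop :=
  P.PosSemidef ∧
    P = Aᵀ * P * A - Aᵀ * P * B * (R + Bᵀ * P * B)⁻¹ * Bᵀ * P * A + Q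

/-- The positive semidefinite solution of the Riccati equation (arbitrary if there is none). -/
def dare {n d : ℕ} (A : Matrix (Fin n) (Fin n) ℝ) (B : Matrix (Fin n) (Fin d) ℝ)
    (Q : Matrix (Fin n) (Fin n) ℝ) (R : Matrix (Fin d) (Fin d) ℝ) : Matrix (Fin n) (Fin n) ℝ :=
  Classical.epsilon (IsDareSolution A B Q R)

/-- The controller `K = -(R + Bᵀ P B)⁻¹ Bᵀ P A` with `P = dare(A, B, Q, R)`. -/
def gain {n d : ℕ} (A : Matrix (Fin n) (Fin n) ℝ) (B : Matrix (Fin n) (Fin d) ℝ)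
    (Q : Matrix (Fin n) (Fin n) ℝ) (R : Matrix (Fin d) (Fin d) ℝ) : Matrix (Fin d) (Fin n) ℝ :=
  -((R + Bᵀ * dare A B Q R * B)⁻¹ * Bᵀ * dare A B Q R * A)

/-- The closed loop matrix `L = A + B K` of the controller `K = gain A B Q R`. -/
def closedLoop {n d : ℕ} (A : Matrix (Fin n) (Fin n) ℝ) (B : Matrix (Fin n) (Fin d) ℝ)
    (Q : Matrix (Fin n) (Fin n) ℝ) (R : Matrix (Fin d) (Fin d) ℝ) : Matrix (Fin n) (Fin n) ℝ :=
  A + B * gain A B Q R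

/-- `Γ = 1 + max {‖A‖, ‖B‖, ‖P‖, ‖K‖}`. -/
def Gam {n d : ℕ} (A : Matrix (Fin n) (Fin n) ℝ) (B : Matrix (Fin n) (Fin d) ℝ)
    (Q : Matrix (Fin n) (Fin n) ℝ) (R : Matrix (Fin d) (Fin d) ℝ) : ℝ :=
  1 + max (max ‖A‖ ‖B‖) (max ‖dare A B Q R‖ ‖gain A B Q R‖)

/-- The joint law of `ω = (x₀, w₀, w₁, …)`: independent, `x₀ ∼ N(0, I)` and `w_t ∼ N(0, σ² I)`. -/
def noiseLaw (n : ℕ) (σ : ℝ) : Measure (ℕ → EuclideanSpace ℝ (Fin n)) :=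
  Measure.infinitePi fun t =>
    if t = 0 then multivariateGaussian 0 (1 : Matrix (Fin n) (Fin n) ℝ)
    else multivariateGaussian 0 (σ ^ 2 • (1 : Matrix (Fin n) (Fin n) ℝ))

/-- The states `x_{t+1} = A x_t + B u_t + w_t` under `u_t = K x_t`,
with `x_0 = ω 0` and `w_t = ω (t + 1)`. -/
def state {n d : ℕ} (A : Matrix (Fin n) (Fin n) ℝ) (B : Matrix (Fin n) (Fin d) ℝ)
    (K : Matrix (Fin d) (Fin n) ℝ) (ω : ℕ → EuclideanSpace ℝ (Fin n)) : ℕ → (Fin n → ℝ)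
  | 0 => (ω 0).ofLp
  | t + 1 => A *ᵥ state A B K ω t + B *ᵥ (K *ᵥ state A B K ω t) + (ω (t + 1)).ofLp

/-- The stage cost `xᵀ Q x + uᵀ R u`. -/
def stageCost {n d : ℕ} (Q : Matrix (Fin n) (Fin n) ℝ) (R : Matrix (Fin d) (Fin d) ℝ)
    (x : Fin n → ℝ) (u : Fin d → ℝ) : ℝ :=
  x ⬝ᵥ (Q *ᵥ x) + u ⬝ᵥ (R *ᵥ u)

/-- `𝔼 [(1/T) ∑_{t=0}^T x_tᵀ Q x_t + u_tᵀ R u_t]` under `u_t = K x_t`. -/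
def avgCost {n d : ℕ} (A : Matrix (Fin n) (Fin n) ℝ) (B : Matrix (Fin n) (Fin d) ℝ)
    (Q : Matrix (Fin n) (Fin n) ℝ) (R : Matrix (Fin d) (Fin d) ℝ) (σ : ℝ)
    (K : Matrix (Fin d) (Fin n) ℝ) (T : ℕ) : ℝ :=
  ∫ ω, (1 / (T : ℝ)) * ∑ t ∈ Finset.range (T + 1),
    stageCost Q R (state A B K ω t) (K *ᵥ state A B K ω t) ∂(noiseLaw n σ)

/-- `J` is the (finite) infinite horizon average cost `J(A, B, K)` of `u_t = K x_t` on `(A, B)`. -/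
def IsCost {n d : ℕ} (A : Matrix (Fin n) (Fin n) ℝ) (B : Matrix (Fin n) (Fin d) ℝ)
    (Q : Matrix (Fin n) (Fin n) ℝ) (R : Matrix (Fin d) (Fin d) ℝ) (σ : ℝ)
    (K : Matrix (Fin d) (Fin n) ℝ) (J : ℝ) : Prop :=
  Tendsto (avgCost A B Q R σ K) atTop (𝓝 J)

/-- `β = max {1, ε τ(A, ρ) + ρ}`. -/
def betaConst {n : ℕ} (A : Matrix (Fin n) (Fin n) ℝ) (ρ ε : ℝ) : ℝ≥0∞ :=
  max 1 (ENNReal.ofReal ε * transient A ρ + ENNReal.ofReal ρ)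

/-- `max {‖Q‖², ‖R‖²} / min {σ_min(Q)², σ_min(R)²}`. -/
def costCondSq {n d : ℕ} (Q : Matrix (Fin n) (Fin n) ℝ) (R : Matrix (Fin d) (Fin d) ℝ) : ℝ :=
  max (‖Q‖ ^ 2) (‖R‖ ^ 2) / min (sigmaMin Q ^ 2) (sigmaMin R ^ 2)

/-- The right hand side of the sub-optimality bound with the numerical constant `C`; it is infinite
if `τ(A, ρ)` or `τ(L, γ)` is. -/
def gapBound {n d : ℕ} (C : ℝ) (A : Matrix (Fin n) (Fin n) ℝ) (B : Matrix (Fin n) (Fin d) ℝ)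
    (Q : Matrix (Fin n) (Fin n) ℝ) (R : Matrix (Fin d) (Fin d) ℝ)
    (σ ρ γ ε ν : ℝ) (ℓ : ℕ) : ℝ≥0∞ :=
  ENNReal.ofReal (C * σ ^ 2 * d * (ℓ : ℝ) ^ 5 * Gam A B Q R ^ 15)
    * transient A ρ ^ 6 * betaConst A ρ ε ^ (4 * (ℓ - 1))
    * (transient (closedLoop A B Q R) γ ^ 2 / ENNReal.ofReal (1 - γ ^ 2))
    * ENNReal.ofReal (costCondSq Q R * (1 + 1 / ν) ^ 2 * ε ^ 2)

end LQR

end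

/-! Write M = R + BᵀPB, K for the optimal gain of the true system, K' for the gain computed from the
estimates and L' = A + BK'. The average cost of a controller is σ² times a sum of traces along
powers of its closed loop (`isCost_of_hasSum`). Completing squares in the Riccati equation shows
that K' exceeds the optimum σ² tr P by σ² times the sum over k and i of the form M at (K' - K) L'^k
e_i (`IsDareSolution.sum_costTerm`). The gap is therefore quadratic in K' - K, and two things
remain: K' - K = O(ε), and L' is stable with a quantitative energy bound.

For the first (`IsDareSolution.perturbation`), P is the value function, so it lies below the cost of
every trajectory. Run K on the estimated system and K' on the true one. If each run costs at most 1
+ δ times the value function its gain comes from, then P' ≤ (1 + δ)P and P ≤ (1 + δ)P', so P' - P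
and hence K' - K are of order δ. The finite cost of the first run also yields the existence of P',
by value iteration from zero.

The factor 1 + δ comes from `perturbed_cost_le`. A mismatch F of the closed loop adds a cross term
between F x_k and the costate λ_{k+1} = P x_{k+1}. The costate satisfies Pontryagin's equations up
to residuals controlled by the stage cost, and controllability of the true pair recovers λ from
these residuals over a window of length ℓ (`vnorm_costate_le`). Cauchy-Schwarz then makes δ linear
in ε. Controllability of the estimated pair is never needed.

For the second (`sum_perturbed_pow_le`), L' is a perturbation of the optimal closed loop. Its
response has two energy bounds, one from the decay τ γ^k and one from the Lyapunov function P. Their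
geometric mean costs a single factor τ²/(1 - γ²) in the smallness condition, which the hypothesis on
the right-hand side supplies. Passing to the transposed loop makes the excess cost a sum over the d
rows of M(K' - K), which explains the factor d. -/

namespace LQR

/-! ### Euclidean norms of vectors and operator norms of matrices -/

section VNorm

variable {ι κ : Type} [Fintype ι] [Fintype κ]

/-- The Euclidean norm of a plain vector. -/
noncomputable def vnorm (x : ι → ℝ) : ℝ := ‖WithLp.toLp 2 x‖

/-- The quadratic form `xᵀ M x`. -/
def quad (M : Matrix ι ι ℝ) (x : ι → ℝ) : ℝ := x ⬝ᵥ (M *ᵥ x)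

lemma vnorm_nonneg (x : ι → ℝ) : 0 ≤ vnorm x := norm_nonneg _

lemma vnorm_add_le (x y : ι → ℝ) : vnorm (x + y) ≤ vnorm x + vnorm y := by
  simpa [vnorm] using norm_add_le (WithLp.toLp 2 x) (WithLp.toLp 2 y)

lemma vnorm_sub_le (x y : ι → ℝ) : vnorm (x - y) ≤ vnorm x + vnorm y := by
  simpa [vnorm] using norm_sub_le (WithLp.toLp 2 x) (WithLp.toLp 2 y)

@[simp] lemma vnorm_neg (x : ι → ℝ) : vnorm (-x) = vnorm x := by simp [vnorm]

@[simp] lemma vnorm_zero : vnorm (0 : ι → ℝ) = 0 := by simp [vnorm]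

lemma vnorm_smul (c : ℝ) (x : ι → ℝ) : vnorm (c • x) = |c| * vnorm x := by
  simp [vnorm, norm_smul]

lemma vnorm_eq_zero {x : ι → ℝ} : vnorm x = 0 ↔ x = 0 := by
  simp [vnorm]

lemma vnorm_sum_le {α : Type*} (s : Finset α) (f : α → ι → ℝ) :
    vnorm (∑ i ∈ s, f i) ≤ ∑ i ∈ s, vnorm (f i) := by
  have h := norm_sum_le s fun i => WithLp.toLp 2 (f i)
  rw [← WithLp.toLp_sum] at h
  exact h

lemma vnorm_sq (x : ι → ℝ) : vnorm x ^ 2 = x ⬝ᵥ x := by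
  rw [vnorm, EuclideanSpace.real_norm_sq_eq]; simp [dotProduct, sq]

lemma abs_dotProduct_le (x y : ι → ℝ) : |x ⬝ᵥ y| ≤ vnorm x * vnorm y := by
  have h := abs_real_inner_le_norm (WithLp.toLp 2 x) (WithLp.toLp 2 y)
  simpa [vnorm, PiLp.inner_apply, dotProduct, mul_comm] using h

lemma dotProduct_le (x y : ι → ℝ) : x ⬝ᵥ y ≤ vnorm x * vnorm y :=
  (le_abs_self _).trans (abs_dotProduct_le x y)

lemma dotProduct_transpose_mulVec (M : Matrix κ ι ℝ) (x : ι → ℝ) (y : κ → ℝ) :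
    x ⬝ᵥ (Mᵀ *ᵥ y) = (M *ᵥ x) ⬝ᵥ y := by
  rw [Matrix.dotProduct_mulVec, Matrix.vecMul_transpose]

lemma dotProduct_symm_mulVec {M : Matrix ι ι ℝ} (hM : Mᵀ = M) (x y : ι → ℝ) :
    x ⬝ᵥ (M *ᵥ y) = y ⬝ᵥ (M *ᵥ x) := by
  rw [← hM, dotProduct_transpose_mulVec, hM, dotProduct_comm]

variable [DecidableEq ι]

lemma vnorm_mulVec_le (M : Matrix κ ι ℝ) (x : ι → ℝ) : vnorm (M *ᵥ x) ≤ ‖M‖ * vnorm x :=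
  Matrix.l2_opNorm_mulVec M (WithLp.toLp 2 x)

lemma vnorm_mulVec_le_of_le {M : Matrix κ ι ℝ} {c : ℝ} (h : ‖M‖ ≤ c) (x : ι → ℝ) :
    vnorm (M *ᵥ x) ≤ c * vnorm x :=
  (vnorm_mulVec_le M x).trans (mul_le_mul_of_nonneg_right h (vnorm_nonneg x))

lemma norm_le_of_vnorm_le {M : Matrix κ ι ℝ} {c : ℝ} (hc : 0 ≤ c)
    (h : ∀ x, vnorm (M *ᵥ x) ≤ c * vnorm x) : ‖M‖ ≤ c := by
  rw [Matrix.l2_opNorm_def]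
  exact ContinuousLinearMap.opNorm_le_bound _ hc fun x => h x.ofLp

lemma norm_transpose [DecidableEq κ] (M : Matrix κ ι ℝ) : ‖Mᵀ‖ = ‖M‖ := by
  rw [← Matrix.conjTranspose_eq_transpose_of_trivial, Matrix.l2_opNorm_conjTranspose]

end VNorm

/-! ### Quadratic forms -/

section Quad

variable {ι κ : Type} [Fintype ι] [Fintype κ]

lemma quad_conj (M : Matrix κ κ ℝ) (F : Matrix κ ι ℝ) (x : ι → ℝ) :
    quad (Fᵀ * M * F) x = quad M (F *ᵥ x) := by
  rw [quad, quad, ← dotProduct_transpose_mulVec, Matrix.mulVec_mulVec, Matrix.mulVec_mulVec,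
    Matrix.mul_assoc]

@[simp] lemma quad_add_left (M N : Matrix ι ι ℝ) (x : ι → ℝ) :
    quad (M + N) x = quad M x + quad N x := by
  simp [quad, Matrix.add_mulVec]

@[simp] lemma quad_sub_left (M N : Matrix ι ι ℝ) (x : ι → ℝ) :
    quad (M - N) x = quad M x - quad N x := by
  simp [quad, Matrix.sub_mulVec]

@[simp] lemma quad_zero_right (M : Matrix ι ι ℝ) : quad M 0 = 0 := by simp [quad]

lemma quad_smul_right (M : Matrix ι ι ℝ) (c : ℝ) (x : ι → ℝ) :
    quad M (c • x) = c ^ 2 * quad M x := by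
  simp [quad, Matrix.mulVec_smul]; ring

lemma quad_add_right {M : Matrix ι ι ℝ} (hM : Mᵀ = M) (x y : ι → ℝ) :
    quad M (x + y) = quad M x + 2 * (x ⬝ᵥ (M *ᵥ y)) + quad M y := by
  simp only [quad, Matrix.mulVec_add, add_dotProduct, dotProduct_add]
  rw [dotProduct_symm_mulVec hM y x]; ring

lemma quad_sub_right {M : Matrix ι ι ℝ} (hM : Mᵀ = M) (x y : ι → ℝ) :
    quad M (x - y) = quad M x - 2 * (x ⬝ᵥ (M *ᵥ y)) + quad M y := by
  simp only [quad, Matrix.mulVec_sub, sub_dotProduct, dotProduct_sub]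
  rw [dotProduct_symm_mulVec hM y x]; ring

lemma _root_.Matrix.PosSemidef.transpose_eq {ι : Type} {M : Matrix ι ι ℝ} (hM : M.PosSemidef) : Mᵀ = M := by
  have := hM.isHermitian
  rwa [Matrix.IsHermitian, Matrix.conjTranspose_eq_transpose_of_trivial] at this

lemma quad_nonneg {M : Matrix ι ι ℝ} (hM : M.PosSemidef) (x : ι → ℝ) : 0 ≤ quad M x := by
  simpa [quad] using hM.dotProduct_mulVec_nonneg x

lemma posSemidef_of_quad_nonneg {M : Matrix ι ι ℝ} (hM : Mᵀ = M) (h : ∀ x, 0 ≤ quad M x) :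
    M.PosSemidef :=
  .of_dotProduct_mulVec_nonneg (by rwa [Matrix.IsHermitian,
    Matrix.conjTranspose_eq_transpose_of_trivial]) (by simpa [quad] using h)

lemma dotProduct_mulVec_sq_le {M : Matrix ι ι ℝ} (hM : M.PosSemidef) (x y : ι → ℝ) :
    (x ⬝ᵥ (M *ᵥ y)) ^ 2 ≤ quad M x * quad M y := by
  have key : ∀ t : ℝ, 0 ≤ quad M y * (t * t) + (2 * (x ⬝ᵥ (M *ᵥ y))) * t + quad M x := by
    intro t
    have := quad_nonneg hM (x + t • y)
    rw [quad_add_right hM.transpose_eq, quad_smul_right, Matrix.mulVec_smul,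
      dotProduct_smul, smul_eq_mul] at this
    linarith
  have := discrim_le_zero key
  rw [discrim] at this
  linarith

lemma eq_of_quad_eq {M N : Matrix ι ι ℝ} (hM : Mᵀ = M) (hN : Nᵀ = N)
    (h : ∀ x, quad M x = quad N x) : M = N := by
  classical
  have key : ∀ x y, x ⬝ᵥ (M *ᵥ y) = x ⬝ᵥ (N *ᵥ y) := fun x y => by
    have h1 := h (x + y)
    rw [quad_add_right hM, quad_add_right hN, h, h] at h1
    linarith
  ext i j
  simpa using key (Pi.single i 1) (Pi.single j 1)

variable [DecidableEq ι]

lemma quad_le_norm (M : Matrix ι ι ℝ) (x : ι → ℝ) : quad M x ≤ ‖M‖ * vnorm x ^ 2 := by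
  have h1 := dotProduct_le x (M *ᵥ x)
  have h2 := vnorm_mulVec_le M x
  have := vnorm_nonneg x
  rw [quad]; nlinarith

lemma quad_le_of_norm_le {M : Matrix ι ι ℝ} {c : ℝ} (h : ‖M‖ ≤ c) (x : ι → ℝ) :
    quad M x ≤ c * vnorm x ^ 2 :=
  (quad_le_norm M x).trans (by gcongr)

/-- This is M² ≤ ‖M‖ M, from Cauchy-Schwarz for the form M applied to Mx and x. -/
lemma vnorm_mulVec_sq_le {M : Matrix ι ι ℝ} (hM : M.PosSemidef) (x : ι → ℝ) :
    vnorm (M *ᵥ x) ^ 2 ≤ ‖M‖ * quad M x := by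
  have h1 := dotProduct_mulVec_sq_le hM (M *ᵥ x) x
  rw [← vnorm_sq] at h1
  have h2 := quad_le_norm M (M *ᵥ x)
  have h3 := quad_nonneg hM x
  rcases (sq_nonneg (vnorm (M *ᵥ x))).eq_or_lt with h | h
  · rw [← h]; positivity
  · have : vnorm (M *ᵥ x) ^ 2 * vnorm (M *ᵥ x) ^ 2 ≤ (‖M‖ * quad M x) * vnorm (M *ᵥ x) ^ 2 := by
      nlinarith
    exact le_of_mul_le_mul_right this h

lemma norm_le_of_abs_quad_le {M : Matrix ι ι ℝ} (hM : Mᵀ = M) {c : ℝ} (hc : 0 ≤ c)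
    (h : ∀ x, |quad M x| ≤ c * vnorm x ^ 2) : ‖M‖ ≤ c := by
  refine norm_le_of_vnorm_le hc fun y => ?_
  have key : ∀ x, 2 * (x ⬝ᵥ (M *ᵥ y)) ≤ c * (vnorm x ^ 2 + vnorm y ^ 2) := fun x => by
    have h1 := (le_abs_self _).trans (h (x + y))
    have h2 := (neg_abs_le _).trans' (neg_le_neg (h (x - y)))
    rw [quad_add_right hM, vnorm_sq] at h1
    rw [quad_sub_right hM, vnorm_sq] at h2
    simp only [vnorm_sq]
    simp only [add_dotProduct, dotProduct_add, sub_dotProduct, dotProduct_sub] at h1 h2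
    nlinarith
  rcases (vnorm_nonneg (M *ᵥ y)).eq_or_lt with h0 | h0
  · rw [← h0]; have := vnorm_nonneg y; positivity
  -- The polarized bound is used at the multiple of My that has the same length as y.
  have h1 := key ((vnorm y / vnorm (M *ᵥ y)) • (M *ᵥ y))
  rw [smul_dotProduct, ← vnorm_sq, vnorm_smul, mul_pow, sq_abs, smul_eq_mul] at h1
  have h2 : vnorm y / vnorm (M *ᵥ y) * vnorm (M *ᵥ y) ^ 2 = vnorm y * vnorm (M *ᵥ y) := by
    field_simp
  have h3 : (vnorm y / vnorm (M *ᵥ y)) ^ 2 * vnorm (M *ᵥ y) ^ 2 = vnorm y ^ 2 := by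
    field_simp
  rw [h2, h3] at h1
  rcases (vnorm_nonneg y).eq_or_lt with h4 | h4
  · have := vnorm_mulVec_le M y
    rw [← h4] at this ⊢; linarith
  · have : vnorm y * vnorm (M *ᵥ y) ≤ vnorm y * (c * vnorm y) := by nlinarith
    exact le_of_mul_le_mul_left this h4

end Quad

/-! ### The smallest singular value -/

section SigmaMin

variable {n : ℕ}

lemma mul_vnorm_sq_le_quad_of_eigenvalues {M : Matrix (Fin n) (Fin n) ℝ} (hM : M.IsHermitian)
    {c : ℝ} (h : ∀ i, c ≤ hM.eigenvalues i) (x : Fin n → ℝ) : c * vnorm x ^ 2 ≤ quad M x := by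
  have hpsd : (M - c • (1 : Matrix (Fin n) (Fin n) ℝ)).PosSemidef := by
    have hd : (Matrix.diagonal fun i => hM.eigenvalues i - c).PosSemidef :=
      Matrix.PosSemidef.diagonal fun i => sub_nonneg.2 (h i)
    have h1 := hd.mul_mul_conjTranspose_same (hM.eigenvectorUnitary : Matrix (Fin n) (Fin n) ℝ)
    convert h1 using 1
    have h2 := hM.spectral_theorem
    rw [Unitary.conjStarAlgAut_apply] at h2
    have h3 : (hM.eigenvectorUnitary : Matrix (Fin n) (Fin n) ℝ) *
        star (hM.eigenvectorUnitary : Matrix (Fin n) (Fin n) ℝ) = 1 :=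
      Unitary.coe_mul_star_self _
    have h4 : (Matrix.diagonal fun i => hM.eigenvalues i - c) =
        Matrix.diagonal hM.eigenvalues - c • (1 : Matrix (Fin n) (Fin n) ℝ) := by
      ext i j; by_cases hij : i = j <;> simp [hij, Matrix.diagonal]
    rw [h4, mul_sub, sub_mul, ← Matrix.star_eq_conjTranspose]
    conv_lhs => rw [h2]
    simp [h3, mul_assoc]
  have := quad_nonneg hpsd x
  rw [quad_sub_left] at this
  simp only [quad, Matrix.smul_mulVec, Matrix.one_mulVec, dotProduct_smul, smul_eq_mul,
    ← vnorm_sq] at this ⊢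
  linarith

lemma sigmaMin_nonneg {κ : Type} [Fintype κ] (M : Matrix (Fin n) κ ℝ) : 0 ≤ sigmaMin M :=
  Real.sqrt_nonneg _

lemma sigmaMin_mul_vnorm_le {κ : Type} [Fintype κ] (M : Matrix (Fin n) κ ℝ)
    (x : Fin n → ℝ) : sigmaMin M * vnorm x ≤ vnorm (Mᵀ *ᵥ x) := by
  refine le_of_sq_le_sq ?_ (vnorm_nonneg _)
  have hM := Matrix.isHermitian_mul_conjTranspose_self M
  have h0 : ∀ i, 0 ≤ hM.eigenvalues i := fun i =>
    (Matrix.posSemidef_self_mul_conjTranspose M).eigenvalues_nonneg i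
  have h1 : sigmaMin M ^ 2 = ⨅ i, hM.eigenvalues i :=
    Real.sq_sqrt (Real.iInf_nonneg h0)
  have h2 := mul_vnorm_sq_le_quad_of_eigenvalues hM (c := sigmaMin M ^ 2)
    (fun i => h1 ▸ ciInf_le ⟨0, by rintro _ ⟨i, rfl⟩; exact h0 i⟩ i) x
  rw [mul_pow, vnorm_sq (Mᵀ *ᵥ x), ← dotProduct_transpose_mulVec, Matrix.transpose_transpose,
    Matrix.mulVec_mulVec]
  simpa [quad] using h2

lemma sigmaMin_pos [Nonempty (Fin n)] {M : Matrix (Fin n) (Fin n) ℝ} (hM : M.PosDef) :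
    0 < sigmaMin M := by
  obtain ⟨i, hi⟩ := Finite.exists_min (Matrix.isHermitian_mul_conjTranspose_self M).eigenvalues
  have h1 : (M * Mᴴ).PosDef := by
    have := (Matrix.PosDef.one (n := Fin n) (R := ℝ)).mul_mul_conjTranspose_same
      (B := M) (Matrix.vecMul_injective_of_isUnit hM.isUnit)
    simpa using this
  refine Real.sqrt_pos.2 (lt_of_lt_of_le (h1.eigenvalues_pos i) (le_ciInf hi))

/-- `sigmaMin` is defined through M Mᵀ; Cauchy-Schwarz for the form M at x and M⁻¹x turns it into a
lower bound for M itself. -/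
lemma sigmaMin_mul_vnorm_sq_le_quad {M : Matrix (Fin n) (Fin n) ℝ} (hM : M.PosDef)
    (x : Fin n → ℝ) : sigmaMin M * vnorm x ^ 2 ≤ quad M x := by
  have hinv : M * M⁻¹ = 1 := Matrix.mul_nonsing_inv _ ((Matrix.isUnit_iff_isUnit_det _).1 hM.isUnit)
  set y := M⁻¹ *ᵥ x with hy
  have hMy : M *ᵥ y = x := by rw [hy, Matrix.mulVec_mulVec, hinv, Matrix.one_mulVec]
  have h1 := dotProduct_mulVec_sq_le hM.posSemidef x y
  have h2 : quad M y ≤ vnorm y * vnorm x := by rw [quad, hMy]; exact dotProduct_le _ _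
  have h3 := sigmaMin_mul_vnorm_le M y
  rw [hM.posSemidef.transpose_eq, hMy] at h3
  rw [hMy, ← vnorm_sq] at h1
  have hq := quad_nonneg hM.posSemidef x
  have hs := sigmaMin_nonneg M
  have hx := vnorm_nonneg x
  rcases hx.eq_or_lt with h0 | h0
  · rw [← h0]; simpa using hq
  have h4 : sigmaMin M * vnorm x ^ 2 * vnorm x ^ 2 ≤ quad M x * vnorm x ^ 2 :=
    calc sigmaMin M * vnorm x ^ 2 * vnorm x ^ 2 = sigmaMin M * (vnorm x ^ 2) ^ 2 := by ring
      _ ≤ sigmaMin M * (quad M x * quad M y) := by gcongr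
      _ ≤ sigmaMin M * (quad M x * (vnorm y * vnorm x)) := by gcongr
      _ = quad M x * ((sigmaMin M * vnorm y) * vnorm x) := by ring
      _ ≤ quad M x * (vnorm x * vnorm x) := by gcongr
      _ = _ := by ring
  exact le_of_mul_le_mul_right h4 (by positivity)

end SigmaMin

/-! ### The Riccati operator and the Bellman equation -/

section Riccati

variable {n d : ℕ} {A : Matrix (Fin n) (Fin n) ℝ} {B : Matrix (Fin n) (Fin d) ℝ}
  {Q : Matrix (Fin n) (Fin n) ℝ} {R : Matrix (Fin d) (Fin d) ℝ} {P : Matrix (Fin n) (Fin n) ℝ}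

/-- The Riccati operator, whose positive semidefinite fixed points solve the Riccati equation. -/
noncomputable def riccatiMap (A : Matrix (Fin n) (Fin n) ℝ) (B : Matrix (Fin n) (Fin d) ℝ)
    (Q : Matrix (Fin n) (Fin n) ℝ) (R : Matrix (Fin d) (Fin d) ℝ) (P : Matrix (Fin n) (Fin n) ℝ) :
    Matrix (Fin n) (Fin n) ℝ :=
  Aᵀ * P * A - Aᵀ * P * B * (R + Bᵀ * P * B)⁻¹ * Bᵀ * P * A + Q

/-- The greedy controller of the value function `xᵀ P x`. -/
noncomputable def greedyGain (A : Matrix (Fin n) (Fin n) ℝ) (B : Matrix (Fin n) (Fin d) ℝ)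
    (R : Matrix (Fin d) (Fin d) ℝ) (P : Matrix (Fin n) (Fin n) ℝ) : Matrix (Fin d) (Fin n) ℝ :=
  -((R + Bᵀ * P * B)⁻¹ * Bᵀ * P * A)

lemma stageCost_eq (x : Fin n → ℝ) (u : Fin d → ℝ) :
    stageCost Q R x u = quad Q x + quad R u := rfl

lemma posDef_add_conj (hR : R.PosDef) (hP : P.PosSemidef) : (R + Bᵀ * P * B).PosDef := by
  have := hP.conjTranspose_mul_mul_same B
  rw [Matrix.conjTranspose_eq_transpose_of_trivial] at this
  exact hR.add_posSemidef this

lemma mul_greedyGain (hR : R.PosDef) (hP : P.PosSemidef) :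
    (R + Bᵀ * P * B) * greedyGain A B R P = -(Bᵀ * P * A) := by
  have h := (Matrix.isUnit_iff_isUnit_det _).1 (posDef_add_conj (B := B) hR hP).isUnit
  rw [greedyGain]
  generalize R + Bᵀ * P * B = M at h ⊢
  simp only [Matrix.mul_neg, Matrix.mul_assoc, Matrix.mul_nonsing_inv_cancel_left _ _ h]

lemma R_mul_greedyGain (hR : R.PosDef) (hP : P.PosSemidef) :
    R * greedyGain A B R P = -(Bᵀ * P * (A + B * greedyGain A B R P)) := by
  have h := mul_greedyGain (A := A) (B := B) hR hP
  rw [Matrix.add_mul] at h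
  rw [Matrix.mul_add, neg_add, ← h, Matrix.mul_assoc (Bᵀ * P)]
  abel

lemma riccatiMap_eq :
    riccatiMap A B Q R P = Aᵀ * P * (A + B * greedyGain A B R P) + Q := by
  rw [riccatiMap, greedyGain]
  simp only [Matrix.mul_add, Matrix.mul_neg, Matrix.mul_assoc, sub_eq_add_neg]

lemma transpose_riccatiMap (hQ : Qᵀ = Q) (hR : R.PosDef) (hP : P.PosSemidef) :
    (riccatiMap A B Q R P)ᵀ = riccatiMap A B Q R P := by
  simp only [riccatiMap, Matrix.transpose_add, Matrix.transpose_sub, Matrix.transpose_mul,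
    Matrix.transpose_transpose, Matrix.transpose_nonsing_inv, hQ, hP.transpose_eq,
    hR.posSemidef.transpose_eq, Matrix.mul_assoc]

/-- Completion of squares in the Bellman equation. -/
lemma quad_riccatiMap_add (hR : R.PosDef) (hP : P.PosSemidef) (x : Fin n → ℝ) (u : Fin d → ℝ) :
    quad (riccatiMap A B Q R P) x + quad (R + Bᵀ * P * B) (u - greedyGain A B R P *ᵥ x) =
      stageCost Q R x u + quad P (A *ᵥ x + B *ᵥ u) := by
  set K := greedyGain A B R P with hK
  have hM := mul_greedyGain (A := A) (B := B) hR hP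
  rw [← hK] at hM
  have hMs := (posDef_add_conj (B := B) hR hP).posSemidef.transpose_eq
  have h1 : ∀ v : Fin d → ℝ, v ⬝ᵥ ((R + Bᵀ * P * B) *ᵥ (K *ᵥ x)) =
      -((A *ᵥ x) ⬝ᵥ (P *ᵥ (B *ᵥ v))) := fun v => by
    rw [dotProduct_symm_mulVec hP.transpose_eq, ← dotProduct_transpose_mulVec, Matrix.mulVec_mulVec,
      hM, Matrix.neg_mulVec, dotProduct_neg, ← Matrix.mulVec_mulVec, ← Matrix.mulVec_mulVec]
  have h2 : quad (riccatiMap A B Q R P) x = quad P (A *ᵥ x) + (A *ᵥ x) ⬝ᵥ (P *ᵥ (B *ᵥ (K *ᵥ x)))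
      + quad Q x := by
    rw [riccatiMap_eq, quad_add_left, quad, Matrix.mul_add, Matrix.add_mulVec, dotProduct_add]
    simp only [← Matrix.mulVec_mulVec, dotProduct_transpose_mulVec]
    rfl
  rw [quad_sub_right hMs, quad_add_right hP.transpose_eq, h1, h2, stageCost_eq]
  have h3 : quad (R + Bᵀ * P * B) (K *ᵥ x) = -((A *ᵥ x) ⬝ᵥ (P *ᵥ (B *ᵥ (K *ᵥ x)))) := h1 _
  rw [h3, quad_add_left, quad_conj]
  ring

lemma quad_riccatiMap_le (hR : R.PosDef) (hP : P.PosSemidef) (x : Fin n → ℝ) (u : Fin d → ℝ) :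
    quad (riccatiMap A B Q R P) x ≤ stageCost Q R x u + quad P (A *ᵥ x + B *ᵥ u) := by
  rw [← quad_riccatiMap_add hR hP]
  have := quad_nonneg (posDef_add_conj (B := B) hR hP).posSemidef (u - greedyGain A B R P *ᵥ x)
  linarith

lemma quad_riccatiMap_greedy (hR : R.PosDef) (hP : P.PosSemidef) (x : Fin n → ℝ) :
    quad (riccatiMap A B Q R P) x = stageCost Q R x (greedyGain A B R P *ᵥ x) +
      quad P (A *ᵥ x + B *ᵥ (greedyGain A B R P *ᵥ x)) := by
  rw [← quad_riccatiMap_add hR hP]; simp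

lemma stageCost_nonneg (hQ : Q.PosSemidef) (hR : R.PosSemidef) (x : Fin n → ℝ) (u : Fin d → ℝ) :
    0 ≤ stageCost Q R x u :=
  add_nonneg (quad_nonneg hQ x) (quad_nonneg hR u)

lemma posSemidef_riccatiMap (hQ : Q.PosSemidef) (hR : R.PosDef) (hP : P.PosSemidef) :
    (riccatiMap A B Q R P).PosSemidef := by
  refine posSemidef_of_quad_nonneg (transpose_riccatiMap hQ.transpose_eq hR hP) fun x => ?_
  rw [quad_riccatiMap_greedy hR hP]
  exact add_nonneg (stageCost_nonneg hQ hR.posSemidef _ _) (quad_nonneg hP _)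

/-- The Riccati operator is a minimum over inputs, so testing the smaller form with the greedy input
of the larger one suffices. -/
lemma quad_riccatiMap_mono (hR : R.PosDef) {P' : Matrix (Fin n) (Fin n) ℝ}
    (hP : P.PosSemidef) (hP' : P'.PosSemidef) (h : ∀ x, quad P x ≤ quad P' x) (x : Fin n → ℝ) :
    quad (riccatiMap A B Q R P) x ≤ quad (riccatiMap A B Q R P') x := by
  rw [quad_riccatiMap_greedy hR hP']
  exact (quad_riccatiMap_le hR hP x _).trans (by gcongr; exact h _)

lemma continuousAt_riccatiMap (hR : R.PosDef) (hP : P.PosSemidef) :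
    ContinuousAt (riccatiMap A B Q R) P := by
  have hu := (Matrix.isUnit_iff_isUnit_det _).1 (posDef_add_conj (B := B) hR hP).isUnit
  have hc : Continuous fun P : Matrix (Fin n) (Fin n) ℝ => R + Bᵀ * P * B := by fun_prop
  have hinv : ContinuousAt (fun P : Matrix (Fin n) (Fin n) ℝ => (R + Bᵀ * P * B)⁻¹) P := by
    simp only [Matrix.inv_def, Ring.inverse_eq_inv']
    exact ((Continuous.matrix_det hc).continuousAt.inv₀ hu.ne_zero).smul
      (Continuous.matrix_adjugate hc).continuousAt
  unfold riccatiMap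
  have h1 : Continuous fun P : Matrix (Fin n) (Fin n) ℝ => Aᵀ * P * A := by fun_prop
  have h2 : ContinuousAt (fun P : Matrix (Fin n) (Fin n) ℝ =>
      Aᵀ * P * B * (R + Bᵀ * P * B)⁻¹ * Bᵀ * P * A) P := by
    have h3 : Continuous fun P : Matrix (Fin n) (Fin n) ℝ => Aᵀ * P * B := by fun_prop
    fun_prop
  exact (h1.continuousAt.sub h2).add continuousAt_const

end Riccati

/-! ### Value functions: uniqueness, value iteration, existence -/

section Trajectories

variable {n d : ℕ} {A : Matrix (Fin n) (Fin n) ℝ} {B : Matrix (Fin n) (Fin d) ℝ}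
  {Q : Matrix (Fin n) (Fin n) ℝ} {R : Matrix (Fin d) (Fin d) ℝ} {P : Matrix (Fin n) (Fin n) ℝ}
  {x : ℕ → Fin n → ℝ} {u : ℕ → Fin d → ℝ}

lemma IsDareSolution.posSemidef (h : IsDareSolution A B Q R P) : P.PosSemidef := h.1

lemma IsDareSolution.riccatiMap_eq (h : IsDareSolution A B Q R P) : riccatiMap A B Q R P = P :=
  h.2.symm

/-- Since Q is positive definite, finite total cost forces the state to zero. This disposes of
terminal terms when the horizon tends to infinity. -/
lemma tendsto_zero_of_sum_stageCost_le (hQ : Q.PosDef) (hR : R.PosDef) {c : ℝ}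
    (hc : ∀ N, ∑ k ∈ Finset.range N, stageCost Q R (x k) (u k) ≤ c) :
    Tendsto (fun k => vnorm (x k) ^ 2) atTop (𝓝 0) := by
  rcases isEmpty_or_nonempty (Fin n) with hn | hn
  · have : ∀ k, x k = 0 := fun k => Subsingleton.elim _ _
    simp [this]
  have hs := summable_of_sum_range_le
    (fun k => stageCost_nonneg hQ.posSemidef hR.posSemidef (x k) (u k)) hc
  have hq := sigmaMin_pos hQ
  have h0 : Tendsto (fun k => (sigmaMin Q)⁻¹ * stageCost Q R (x k) (u k)) atTop (𝓝 0) := by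
    simpa using hs.tendsto_atTop_zero.const_mul (sigmaMin Q)⁻¹
  refine squeeze_zero (fun k => by positivity) (fun k => ?_) h0
  rw [← div_eq_inv_mul, le_div_iff₀ hq, stageCost_eq]
  have h1 := sigmaMin_mul_vnorm_sq_le_quad hQ (x k)
  have h2 := quad_nonneg hR.posSemidef (u k)
  linarith

lemma IsDareSolution.quad_le_sum_add (h : IsDareSolution A B Q R P) (hR : R.PosDef)
    (hx : ∀ k, x (k + 1) = A *ᵥ x k + B *ᵥ u k) (N : ℕ) :
    quad P (x 0) ≤ ∑ k ∈ Finset.range N, stageCost Q R (x k) (u k) + quad P (x N) := by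
  induction N with
  | zero => simp
  | succ N ih =>
    rw [Finset.sum_range_succ]
    have := quad_riccatiMap_le (A := A) (B := B) (Q := Q) hR h.posSemidef (x N) (u N)
    rw [h.riccatiMap_eq, ← hx] at this
    linarith

/-- A Riccati solution is below the cost of every trajectory. -/
lemma IsDareSolution.quad_le_of_sum_le (h : IsDareSolution A B Q R P) (hQ : Q.PosDef)
    (hR : R.PosDef) (hx : ∀ k, x (k + 1) = A *ᵥ x k + B *ᵥ u k) {c : ℝ}
    (hc : ∀ N, ∑ k ∈ Finset.range N, stageCost Q R (x k) (u k) ≤ c) :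
    quad P (x 0) ≤ c := by
  have h0 : Tendsto (fun k => c + ‖P‖ * vnorm (x k) ^ 2) atTop (𝓝 (c + ‖P‖ * 0)) :=
    ((tendsto_zero_of_sum_stageCost_le hQ hR hc).const_mul _).const_add _
  rw [mul_zero, add_zero] at h0
  refine ge_of_tendsto' h0 fun N => ?_
  exact (h.quad_le_sum_add hR hx N).trans (add_le_add (hc N) (quad_le_norm P _))

lemma IsDareSolution.sum_greedy_le (h : IsDareSolution A B Q R P) (hR : R.PosDef)
    (hx : ∀ k, x (k + 1) = A *ᵥ x k + B *ᵥ (greedyGain A B R P *ᵥ x k)) (N : ℕ) :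
    ∑ k ∈ Finset.range N, stageCost Q R (x k) (greedyGain A B R P *ᵥ x k) ≤ quad P (x 0) := by
  have key : ∀ N, ∑ k ∈ Finset.range N, stageCost Q R (x k) (greedyGain A B R P *ᵥ x k)
      + quad P (x N) = quad P (x 0) := fun N => by
    induction N with
    | zero => simp
    | succ N ih =>
      rw [Finset.sum_range_succ, ← ih, hx]
      have := quad_riccatiMap_greedy (A := A) (B := B) (Q := Q) hR h.posSemidef (x N)
      rw [h.riccatiMap_eq] at this
      linarith
  have := quad_nonneg h.posSemidef (x N)
  linarith [key N]

/-- The greedy trajectory of one solution costs at most that solution, and the other solution lies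
below the cost of every trajectory. By symmetry the two agree. -/
lemma IsDareSolution.unique (hQ : Q.PosDef) (hR : R.PosDef) {P' : Matrix (Fin n) (Fin n) ℝ}
    (h : IsDareSolution A B Q R P) (h' : IsDareSolution A B Q R P') : P = P' := by
  have key : ∀ {P P' : Matrix (Fin n) (Fin n) ℝ}, IsDareSolution A B Q R P →
      IsDareSolution A B Q R P' → ∀ v, quad P v ≤ quad P' v := fun {P P'} h h' v => by
    let x : ℕ → Fin n → ℝ := fun k => (A + B * greedyGain A B R P') ^ k *ᵥ v
    have hx : ∀ k, x (k + 1) = A *ᵥ x k + B *ᵥ (greedyGain A B R P' *ᵥ x k) := fun k => by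
      simp only [x, pow_succ', ← Matrix.mulVec_mulVec, Matrix.add_mulVec]
    have := h.quad_le_of_sum_le hQ hR hx (h'.sum_greedy_le hR hx)
    simpa [x] using this
  exact eq_of_quad_eq h.posSemidef.transpose_eq h'.posSemidef.transpose_eq fun v =>
    le_antisymm (key h h' v) (key h' h v)

/-- Value iteration started from zero. -/
noncomputable def valueIter (A : Matrix (Fin n) (Fin n) ℝ) (B : Matrix (Fin n) (Fin d) ℝ)
    (Q : Matrix (Fin n) (Fin n) ℝ) (R : Matrix (Fin d) (Fin d) ℝ) (N : ℕ) :
    Matrix (Fin n) (Fin n) ℝ :=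
  (riccatiMap A B Q R)^[N] 0

lemma valueIter_succ (N : ℕ) :
    valueIter A B Q R (N + 1) = riccatiMap A B Q R (valueIter A B Q R N) :=
  Function.iterate_succ_apply' _ _ _

lemma posSemidef_valueIter (hQ : Q.PosSemidef) (hR : R.PosDef) (N : ℕ) :
    (valueIter A B Q R N).PosSemidef := by
  induction N with
  | zero => exact .zero
  | succ N ih => rw [valueIter_succ]; exact posSemidef_riccatiMap hQ hR ih

lemma monotone_quad_valueIter (hQ : Q.PosSemidef) (hR : R.PosDef) (v : Fin n → ℝ) :
    Monotone fun N => quad (valueIter A B Q R N) v := by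
  refine monotone_nat_of_le_succ fun N => ?_
  induction N generalizing v with
  | zero =>
    have := quad_nonneg (posSemidef_valueIter (A := A) (B := B) hQ hR 1) v
    simpa [valueIter, quad] using this
  | succ N ih =>
    rw [valueIter_succ, valueIter_succ (N + 1)]
    exact quad_riccatiMap_mono hR (posSemidef_valueIter hQ hR _) (posSemidef_valueIter hQ hR _) ih v

lemma quad_valueIter_le (hQ : Q.PosSemidef) (hR : R.PosDef)
    (hx : ∀ k, x (k + 1) = A *ᵥ x k + B *ᵥ u k) (N : ℕ) :
    quad (valueIter A B Q R N) (x 0) ≤ ∑ k ∈ Finset.range N, stageCost Q R (x k) (u k) := by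
  induction N generalizing x u with
  | zero => simp [valueIter, quad]
  | succ N ih =>
    have h1 := ih (x := fun k => x (k + 1)) (u := fun k => u (k + 1)) fun k => hx (k + 1)
    have h2 := quad_riccatiMap_le (A := A) (B := B) (Q := Q) hR
      (posSemidef_valueIter (A := A) (B := B) hQ hR N) (x 0) (u 0)
    rw [← hx, ← valueIter_succ] at h2
    rw [Finset.sum_range_succ']
    simp only [zero_add] at h1 h2
    linarith

/-- The iterates increase as quadratic forms, so boundedness makes them converge; continuity of the
Riccati operator makes the limit a fixed point. -/
lemma exists_isDareSolution (hQ : Q.PosDef) (hR : R.PosDef)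
    (hb : ∀ v, ∃ c, ∀ N, quad (valueIter A B Q R N) v ≤ c) :
    ∃ P, IsDareSolution A B Q R P := by
  have hpsd := posSemidef_valueIter (A := A) (B := B) hQ.posSemidef hR
  have hlim : ∀ v, ∃ l, Tendsto (fun N => quad (valueIter A B Q R N) v) atTop (𝓝 l) := fun v => by
    obtain ⟨c, hc⟩ := hb v
    exact ⟨_, tendsto_atTop_ciSup (monotone_quad_valueIter hQ.posSemidef hR v)
      ⟨c, by rintro _ ⟨N, rfl⟩; exact hc N⟩⟩
  choose f hf using hlim
  let e : Fin n → Fin n → ℝ := fun i => Pi.single i 1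
  -- Entries of the limit are recovered from the limiting form by polarization.
  let P : Matrix (Fin n) (Fin n) ℝ := Matrix.of fun i j => (f (e i + e j) - f (e i) - f (e j)) / 2
  have hP : Tendsto (valueIter A B Q R) atTop (𝓝 P) := by
    refine tendsto_pi_nhds.2 fun i => tendsto_pi_nhds.2 fun j => ?_
    have h1 := (((hf (e i + e j)).sub (hf (e i))).sub (hf (e j))).div_const 2
    refine h1.congr fun N => ?_
    rw [quad_add_right (hpsd N).transpose_eq]
    simp [e]
    ring
  have hquad : ∀ v, Tendsto (fun N => quad (valueIter A B Q R N) v) atTop (𝓝 (quad P v)) := fun v =>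
    ((show Continuous fun M : Matrix (Fin n) (Fin n) ℝ => quad M v by
      unfold quad; fun_prop).tendsto P).comp hP
  have hPsd : P.PosSemidef := by
    refine posSemidef_of_quad_nonneg ?_ fun v => ge_of_tendsto' (hquad v) fun N =>
      quad_nonneg (hpsd N) v
    ext i j
    simp only [P, Matrix.transpose_apply, Matrix.of_apply, add_comm (e j)]
    ring
  refine ⟨P, hPsd, ?_⟩
  have h1 := (continuousAt_riccatiMap (A := A) (B := B) (Q := Q) hR hPsd).tendsto.comp hP
  have h2 := (tendsto_add_atTop_iff_nat 1).2 hP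
  refine tendsto_nhds_unique h2 (h1.congr fun N => ?_)
  rw [valueIter_succ]; rfl

/-- One trajectory of finite cost from each initial state suffices, as value iteration stays below
its cost. This serves both the true and the estimated system. -/
lemma existsUnique_isDareSolution (hQ : Q.PosDef) (hR : R.PosDef)
    (hb : ∀ v, ∃ (c : ℝ) (x : ℕ → Fin n → ℝ) (u : ℕ → Fin d → ℝ), x 0 = v ∧
      (∀ k, x (k + 1) = A *ᵥ x k + B *ᵥ u k) ∧
      ∀ N, ∑ k ∈ Finset.range N, stageCost Q R (x k) (u k) ≤ c) :
    ∃! P, IsDareSolution A B Q R P := by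
  obtain ⟨P, hP⟩ := exists_isDareSolution (A := A) (B := B) hQ hR fun v => by
    obtain ⟨c, x, u, rfl, hx, hc⟩ := hb v
    exact ⟨c, fun N => (quad_valueIter_le hQ.posSemidef hR hx N).trans (hc N)⟩
  exact ⟨P, hP, fun P' hP' => hP'.unique hQ hR hP⟩

end Trajectories

/-! ### Controllability: observing costates and steering to zero -/

section Controllability

variable {n d : ℕ} {A : Matrix (Fin n) (Fin n) ℝ} {B : Matrix (Fin n) (Fin d) ℝ}
  {Q : Matrix (Fin n) (Fin n) ℝ} {R : Matrix (Fin d) (Fin d) ℝ} {ℓ : ℕ} {ν : ℝ}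

lemma ctrbMatrix_mulVec (w : Fin ℓ × Fin d → ℝ) :
    ctrbMatrix A B ℓ *ᵥ w = ∑ j : Fin ℓ, (A ^ (j : ℕ) * B) *ᵥ fun a => w (j, a) := by
  ext i
  simp [ctrbMatrix, Matrix.mulVec, dotProduct, Fintype.sum_prod_type, Finset.sum_apply]

lemma ctrbMatrix_transpose_mulVec (v : Fin n → ℝ) (p : Fin ℓ × Fin d) :
    ((ctrbMatrix A B ℓ)ᵀ *ᵥ v) p = (Bᵀ *ᵥ (Aᵀ ^ (p.1 : ℕ) *ᵥ v)) p.2 := by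
  rw [Matrix.mulVec_mulVec, ← Matrix.transpose_pow, ← Matrix.transpose_mul]
  simp [ctrbMatrix, Matrix.mulVec, dotProduct]

lemma IsControllable.mul_vnorm_le (h : IsControllable A B ℓ ν) (v : Fin n → ℝ) :
    ν * vnorm v ≤ ∑ j ∈ Finset.range ℓ, vnorm (Bᵀ *ᵥ (Aᵀ ^ j *ᵥ v)) := by
  have h1 := sigmaMin_mul_vnorm_le (ctrbMatrix A B ℓ) v
  have h2 : ν * vnorm v ≤ sigmaMin (ctrbMatrix A B ℓ) * vnorm v :=
    mul_le_mul_of_nonneg_right h (vnorm_nonneg v)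
  refine h2.trans (h1.trans ?_)
  have h3 : vnorm ((ctrbMatrix A B ℓ)ᵀ *ᵥ v) ^ 2 =
      ∑ j ∈ Finset.range ℓ, vnorm (Bᵀ *ᵥ (Aᵀ ^ j *ᵥ v)) ^ 2 := by
    rw [← Fin.sum_univ_eq_sum_range (fun j => vnorm (Bᵀ *ᵥ (Aᵀ ^ j *ᵥ v)) ^ 2)]
    simp only [vnorm_sq, dotProduct, Fintype.sum_prod_type, ctrbMatrix_transpose_mulVec]
  refine le_of_sq_le_sq ?_ (Finset.sum_nonneg fun _ _ => vnorm_nonneg _)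
  rw [h3]
  exact Finset.sum_sq_le_sq_sum_of_nonneg fun _ _ => vnorm_nonneg _

lemma IsControllable.exists_mulVec_eq (h : IsControllable A B ℓ ν) (hν : 0 < ν) (v : Fin n → ℝ) :
    ∃ w, ctrbMatrix A B ℓ *ᵥ w = v := by
  set C := ctrbMatrix A B ℓ
  have hinj : Function.Injective (C * Cᵀ).mulVec := by
    refine (injective_iff_map_eq_zero (C * Cᵀ).mulVecLin).2 fun y hy => ?_
    rw [Matrix.mulVecLin_apply, ← Matrix.mulVec_mulVec] at hy
    have h1 := sigmaMin_mul_vnorm_le C y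
    have h2 : vnorm (Cᵀ *ᵥ y) ^ 2 = 0 := by
      rw [vnorm_sq, ← dotProduct_transpose_mulVec, Matrix.transpose_transpose, hy, dotProduct_zero]
    rw [pow_eq_zero_iff two_ne_zero] at h2
    rw [h2] at h1
    have h3 : 0 < sigmaMin C := hν.trans_le h
    have h4 := vnorm_nonneg y
    exact vnorm_eq_zero.1 (by nlinarith)
  have hu := Matrix.mulVec_injective_iff_isUnit.1 hinj
  obtain ⟨y, hy⟩ := Matrix.mulVec_surjective_iff_isUnit.2 hu v
  exact ⟨Cᵀ *ᵥ y, by rw [Matrix.mulVec_mulVec, hy]⟩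

/-- The state driven by the inputs `u` from `v`. -/
noncomputable def driven (A : Matrix (Fin n) (Fin n) ℝ) (B : Matrix (Fin n) (Fin d) ℝ)
    (u : ℕ → Fin d → ℝ) (v : Fin n → ℝ) : ℕ → Fin n → ℝ
  | 0 => v
  | k + 1 => A *ᵥ driven A B u v k + B *ᵥ u k

lemma driven_eq_sum (u : ℕ → Fin d → ℝ) (v : Fin n → ℝ) (k : ℕ) :
    driven A B u v k = A ^ k *ᵥ v + ∑ j ∈ Finset.range k, (A ^ j * B) *ᵥ u (k - 1 - j) := by
  induction k with
  | zero => simp [driven]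
  | succ k ih =>
    rw [driven, ih, Finset.sum_range_succ', Matrix.mulVec_add, Matrix.mulVec_mulVec, ← pow_succ',
      Matrix.mulVec_sum]
    simp only [Matrix.mulVec_mulVec, ← Matrix.mul_assoc, ← pow_succ', add_assoc]
    simp [Nat.sub_sub, add_comm 1]

/-- Every state can be steered to zero in ℓ steps and kept there at no cost. -/
lemma IsControllable.existsUnique_dare (h : IsControllable A B ℓ ν) (hν : 0 < ν) (hQ : Q.PosDef)
    (hR : R.PosDef) : ∃! P, IsDareSolution A B Q R P := by
  refine existsUnique_isDareSolution hQ hR fun v => ?_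
  obtain ⟨w, hw⟩ := h.exists_mulVec_eq hν (-(A ^ ℓ *ᵥ v))
  -- The block A^j B acts on the input applied j steps before the last, so the blocks of w are used
  -- in reverse order.
  let u : ℕ → Fin d → ℝ := fun k a => if hk : k < ℓ then w (⟨ℓ - 1 - k, by omega⟩, a) else 0
  have hℓ : driven A B u v ℓ = 0 := by
    rw [driven_eq_sum, ← Fin.sum_univ_eq_sum_range (fun j => (A ^ j * B) *ᵥ u (ℓ - 1 - j))]
    have : ∀ j : Fin ℓ, u (ℓ - 1 - j) = fun a => w (j, a) := fun j => by
      ext a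
      have h1 : ℓ - 1 - (j : ℕ) < ℓ := by omega
      have h2 : ℓ - 1 - (ℓ - 1 - (j : ℕ)) = j := by omega
      simp [u, h1, h2]
    simp only [this, ← ctrbMatrix_mulVec, hw, add_neg_cancel]
  have hu0 : ∀ k, u (ℓ + k) = 0 := fun k => by ext a; simp [u]
  have hx0 : ∀ k, driven A B u v (ℓ + k) = 0 := fun k => by
    induction k with
    | zero => exact hℓ
    | succ k ih => rw [← add_assoc, driven, ih, hu0]; simp
  have hzero : ∀ k, stageCost Q R (driven A B u v (ℓ + k)) (u (ℓ + k)) = 0 := fun k => by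
    simp [hx0, hu0, stageCost]
  refine ⟨∑ k ∈ Finset.range ℓ, stageCost Q R (driven A B u v k) (u k), driven A B u v, u, rfl,
    fun k => rfl, fun N => ?_⟩
  have h0 : ∀ k, 0 ≤ stageCost Q R (driven A B u v k) (u k) := fun k =>
    stageCost_nonneg hQ.posSemidef hR.posSemidef _ _
  calc _ ≤ ∑ k ∈ Finset.range (ℓ + N), stageCost Q R (driven A B u v k) (u k) :=
        Finset.sum_le_sum_of_subset_of_nonneg (Finset.range_subset_range.2 (by omega))
          fun k _ _ => h0 k
    _ = _ := by rw [Finset.sum_range_add, Finset.sum_eq_zero (fun k _ => hzero k), add_zero]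

end Controllability

/-! ### Sums over sliding windows -/

section Sums

lemma sum_range_shift_le {g : ℕ → ℝ} (hg : ∀ k, 0 ≤ g k) (m j l : ℕ) (h : m + j ≤ l) :
    ∑ i ∈ Finset.range j, g (m + i) ≤ ∑ i ∈ Finset.range l, g i :=
  calc _ ≤ ∑ i ∈ Finset.range m, g i + ∑ i ∈ Finset.range j, g (m + i) :=
        le_add_of_nonneg_left (Finset.sum_nonneg fun i _ => hg i)
    _ = ∑ i ∈ Finset.range (m + j), g i := (Finset.sum_range_add _ _ _).symm
    _ ≤ _ := Finset.sum_le_sum_of_subset_of_nonneg (Finset.range_subset_range.2 h)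
        fun i _ _ => hg i

lemma sum_window_sq_le {g : ℕ → ℝ} (l N : ℕ) :
    ∑ k ∈ Finset.range N, (∑ i ∈ Finset.range l, g (k + i)) ^ 2 ≤
      (l : ℝ) ^ 2 * ∑ k ∈ Finset.range (l + N), g k ^ 2 := by
  calc _ ≤ ∑ k ∈ Finset.range N, (l : ℝ) * ∑ i ∈ Finset.range l, g (k + i) ^ 2 := by
        refine Finset.sum_le_sum fun k _ => ?_
        simpa using sq_sum_le_card_mul_sum_sq (s := Finset.range l) (f := fun i => g (k + i))
    _ = l * ∑ i ∈ Finset.range l, ∑ k ∈ Finset.range N, g (i + k) ^ 2 := by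
        rw [← Finset.mul_sum, Finset.sum_comm]
        simp only [add_comm]
    _ ≤ l * ∑ i ∈ Finset.range l, ∑ k ∈ Finset.range (l + N), g k ^ 2 := by
        gcongr with i hi
        exact sum_range_shift_le (g := fun k => g k ^ 2) (fun k => sq_nonneg _) i N (l + N)
          (by have := Finset.mem_range.1 hi; omega)
    _ = _ := by simp; ring

lemma sum_mul_le_of_sq_le {f g : ℕ → ℝ} {N : ℕ} {a b c : ℝ} (hc : 0 ≤ c)
    (hf : ∑ k ∈ Finset.range N, f k ^ 2 ≤ a) (hg : ∑ k ∈ Finset.range N, g k ^ 2 ≤ b)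
    (h : a * b ≤ c ^ 2) : ∑ k ∈ Finset.range N, f k * g k ≤ c := by
  refine le_of_sq_le_sq ?_ hc
  refine (Finset.sum_mul_sq_le_sq_mul_sq _ _ _).trans (le_trans ?_ h)
  have h1 : 0 ≤ ∑ k ∈ Finset.range N, g k ^ 2 := Finset.sum_nonneg fun _ _ => sq_nonneg _
  have h2 : 0 ≤ ∑ k ∈ Finset.range N, f k ^ 2 := Finset.sum_nonneg fun _ _ => sq_nonneg _
  exact mul_le_mul hf hg h1 (h2.trans hf)

end Sums

/-! ### Recovering the costate from the residuals of its recursion -/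

section Costate

variable {n d ℓ : ℕ} {A : Matrix (Fin n) (Fin n) ℝ} {B : Matrix (Fin n) (Fin d) ℝ}
  {ν α Γ : ℝ} {lam a : ℕ → Fin n → ℝ} {b : ℕ → Fin d → ℝ}

lemma costate_eq (h : ∀ k, lam k = Aᵀ *ᵥ lam (k + 1) + a k) (m j : ℕ) :
    lam m = Aᵀ ^ j *ᵥ lam (m + j) + ∑ i ∈ Finset.range j, Aᵀ ^ i *ᵥ a (m + i) := by
  induction j with
  | zero => simp
  | succ j ih =>
    rw [ih, h (m + j), Finset.sum_range_succ, Matrix.mulVec_add, Matrix.mulVec_mulVec, ← pow_succ]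
    simp only [add_assoc]
    abel

lemma vnorm_transpose_pow_mulVec_le {i : ℕ} (h : ‖A ^ i‖ ≤ α) (v : Fin n → ℝ) :
    vnorm (Aᵀ ^ i *ᵥ v) ≤ α * vnorm v := by
  rw [← Matrix.transpose_pow]
  exact vnorm_mulVec_le_of_le (by rwa [norm_transpose]) v

/-- Controllability bounds a costate by the residuals of its recursion over a window. -/
lemma vnorm_costate_le
    (hctrl : ∀ v, ν * vnorm v ≤ ∑ j ∈ Finset.range ℓ, vnorm (Bᵀ *ᵥ (Aᵀ ^ j *ᵥ v)))
    (hν : 0 < ν) (hℓ : 1 ≤ ℓ) (hα : 1 ≤ α) (hA : ∀ i < ℓ, ‖A ^ i‖ ≤ α) (hΓ : 1 ≤ Γ) (hB : ‖B‖ ≤ Γ)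
    (h : ∀ k, lam k = Aᵀ *ᵥ lam (k + 1) + a k) (hb : ∀ k, Bᵀ *ᵥ lam (k + 1) = b k) (k : ℕ) :
    vnorm (lam (k + 1)) ≤ (1 + 1 / ν) * ℓ * Γ * α ^ 2 *
      ∑ i ∈ Finset.range ℓ, (vnorm (a (k + i)) + vnorm (b (k + i))) := by
  have hBt : ‖Bᵀ‖ ≤ Γ := by rwa [norm_transpose]
  set Sa := ∑ i ∈ Finset.range ℓ, vnorm (a (k + i)) with hSa
  set Sb := ∑ i ∈ Finset.range ℓ, vnorm (b (k + i)) with hSb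
  have hSa0 : 0 ≤ Sa := Finset.sum_nonneg fun _ _ => vnorm_nonneg _
  have hSb0 : 0 ≤ Sb := Finset.sum_nonneg fun _ _ => vnorm_nonneg _
  have hsum : ∀ m j, m + j ≤ ℓ → j ≤ ℓ →
      vnorm (∑ i ∈ Finset.range j, Aᵀ ^ i *ᵥ a (k + m + i)) ≤ α * Sa := fun m j hmj hj => by
    refine (vnorm_sum_le _ _).trans ?_
    refine (Finset.sum_le_sum (g := fun i => α * vnorm (a (k + (m + i)))) fun i hi => ?_).trans ?_
    · rw [add_assoc]
      exact vnorm_transpose_pow_mulVec_le (hA i ((Finset.mem_range.1 hi).trans_le hj)) _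
    · rw [← Finset.mul_sum]
      exact mul_le_mul_of_nonneg_left
        (sum_range_shift_le (g := fun i => vnorm (a (k + i))) (fun _ => vnorm_nonneg _) m j ℓ hmj)
        (by linarith)
  -- Each observation of the costate at the end of the window is, up to terms in a, the value of b
  -- at an earlier time of the window.
  have hterm : ∀ j ∈ Finset.range ℓ, vnorm (Bᵀ *ᵥ (Aᵀ ^ j *ᵥ lam (k + ℓ))) ≤
      vnorm (b (k + (ℓ - 1 - j))) + Γ * (α * Sa) := fun j hj => by
    have hj' := Finset.mem_range.1 hj
    obtain ⟨p, rfl⟩ : ∃ p, ℓ = p + 1 + j := ⟨ℓ - 1 - j, by omega⟩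
    have h1 := costate_eq h (k + (p + 1)) j
    have h2 : Aᵀ ^ j *ᵥ lam (k + (p + 1 + j)) = lam (k + p + 1) -
        ∑ i ∈ Finset.range j, Aᵀ ^ i *ᵥ a (k + (p + 1) + i) := by
      rw [show k + p + 1 = k + (p + 1) by ring, h1]
      simp only [add_assoc, add_sub_cancel_right]
    have h3 : p + 1 + j - 1 - j = p := by omega
    rw [h2, Matrix.mulVec_sub, hb, h3]
    refine (vnorm_sub_le _ _).trans ?_
    gcongr
    refine (vnorm_mulVec_le_of_le hBt _).trans ?_
    gcongr
    exact hsum (p + 1) j le_rfl (by omega)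
  have hend : ν * vnorm (lam (k + ℓ)) ≤ Sb + ℓ * (Γ * (α * Sa)) := by
    refine (hctrl _).trans ((Finset.sum_le_sum hterm).trans (le_of_eq ?_))
    rw [Finset.sum_add_distrib, Finset.sum_range_reflect (fun i => vnorm (b (k + i))), ← hSb]
    simp
  -- The bound at the end of the window is carried back to its start by the recursion.
  have hfirst : vnorm (lam (k + 1)) ≤ α * vnorm (lam (k + ℓ)) + α * Sa := by
    have h1 := costate_eq h (k + 1) (ℓ - 1)
    have h2 : k + 1 + (ℓ - 1) = k + ℓ := by omega
    rw [h1, h2]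
    refine (vnorm_add_le _ _).trans ?_
    gcongr
    · exact vnorm_transpose_pow_mulVec_le (hA _ (by omega)) _
    · exact hsum 1 (ℓ - 1) (by omega) (by omega)
  have hℓ' : (1 : ℝ) ≤ ℓ := by exact_mod_cast hℓ
  have hw : (1 : ℝ) ≤ ℓ * Γ * α := by
    have : (1 : ℝ) ≤ ℓ * Γ := one_le_mul_of_one_le_of_one_le hℓ' hΓ
    exact one_le_mul_of_one_le_of_one_le this hα
  have hend' : vnorm (lam (k + ℓ)) ≤ 1 / ν * (ℓ * Γ * α * (Sa + Sb)) := by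
    rw [one_div, ← div_eq_inv_mul, le_div_iff₀ hν, mul_comm]
    refine hend.trans ?_
    nlinarith [mul_le_mul_of_nonneg_right hw hSb0]
  rw [Finset.sum_add_distrib, ← hSa, ← hSb]
  calc vnorm (lam (k + 1)) ≤ α * (1 / ν * (ℓ * Γ * α * (Sa + Sb))) + α * Sa := by
        refine hfirst.trans ?_
        gcongr
    _ ≤ α * (1 / ν * (ℓ * Γ * α * (Sa + Sb))) + α * (ℓ * Γ * α * (Sa + Sb)) := by
        gcongr
        nlinarith [mul_le_mul_of_nonneg_right hw (add_nonneg hSa0 hSb0)]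
    _ = _ := by ring

end Costate

/-- Quantitative bounds on a controllable pair. -/
structure ControlBounds {n d : ℕ} (A : Matrix (Fin n) (Fin n) ℝ) (B : Matrix (Fin n) (Fin d) ℝ)
    (ℓ : ℕ) (ν α Γ : ℝ) : Prop where
  ctrl : ∀ v, ν * vnorm v ≤ ∑ j ∈ Finset.range ℓ, vnorm (Bᵀ *ᵥ (Aᵀ ^ j *ᵥ v))
  ν_pos : 0 < ν
  one_le_ℓ : 1 ≤ ℓ
  one_le_α : 1 ≤ α
  norm_pow_le : ∀ i < ℓ, ‖A ^ i‖ ≤ α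
  one_le_Γ : 1 ≤ Γ
  norm_A_le : ‖A‖ ≤ Γ
  norm_B_le : ‖B‖ ≤ Γ

/-- Quantitative bounds on the cost matrices; `s ^ 2` plays the role of a condition number. -/
structure CostBounds {n d : ℕ} (Q : Matrix (Fin n) (Fin n) ℝ) (R : Matrix (Fin d) (Fin d) ℝ)
    (q c s : ℝ) : Prop where
  posDef_Q : Q.PosDef
  posDef_R : R.PosDef
  q_pos : 0 < q
  le_quad : ∀ x, q * vnorm x ^ 2 ≤ quad Q x
  one_le_c : 1 ≤ c
  norm_Q_le : ‖Q‖ ≤ c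
  norm_R_le : ‖R‖ ≤ c
  one_le_s : 1 ≤ s
  le_s_sq : c ≤ s ^ 2 * q
  vnorm_sq_le : ∀ u, vnorm u ^ 2 ≤ quad R u

/-! ### State, input and weighted vectors against the stage cost -/

section

variable {n d : ℕ} {Q : Matrix (Fin n) (Fin n) ℝ} {R : Matrix (Fin d) (Fin d) ℝ} {q c s : ℝ}

lemma CostBounds.vnorm_sq_le_mul (h : CostBounds Q R q c s) (x : Fin n → ℝ) (u : Fin d → ℝ) :
    vnorm x ^ 2 ≤ s ^ 2 * stageCost Q R x u := by
  have h1 := h.le_quad x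
  have h2 := quad_nonneg h.posDef_R.posSemidef u
  have h3 : 1 ≤ s ^ 2 * q := h.one_le_c.trans h.le_s_sq
  rw [stageCost_eq]
  calc vnorm x ^ 2 ≤ s ^ 2 * q * vnorm x ^ 2 := le_mul_of_one_le_left (sq_nonneg _) h3
    _ = s ^ 2 * (q * vnorm x ^ 2) := by ring
    _ ≤ s ^ 2 * (quad Q x + quad R u) := by gcongr; linarith

lemma CostBounds.mulVec_sq_add_le (h : CostBounds Q R q c s) (x : Fin n → ℝ) (u : Fin d → ℝ) :
    vnorm (Q *ᵥ x) ^ 2 + vnorm (R *ᵥ u) ^ 2 ≤ c * stageCost Q R x u := by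
  have h1 := vnorm_mulVec_sq_le h.posDef_Q.posSemidef x
  have h2 := vnorm_mulVec_sq_le h.posDef_R.posSemidef u
  have h3 := mul_le_mul_of_nonneg_right h.norm_Q_le (quad_nonneg h.posDef_Q.posSemidef x)
  have h4 := mul_le_mul_of_nonneg_right h.norm_R_le (quad_nonneg h.posDef_R.posSemidef u)
  rw [stageCost_eq]; linarith

end

/-! ### Cost of a policy along a perturbed closed loop -/

section PerturbedCost

variable {n d ℓ : ℕ} {A A₁ : Matrix (Fin n) (Fin n) ℝ} {B B₁ : Matrix (Fin n) (Fin d) ℝ}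
  {Q P F : Matrix (Fin n) (Fin n) ℝ} {R : Matrix (Fin d) (Fin d) ℝ} {K : Matrix (Fin d) (Fin n) ℝ}
  {ν α Γ q c s ε : ℝ} {x : ℕ → Fin n → ℝ}

/-- Closed loop Lyapunov identity. -/
lemma quad_closedLoop_add (hP : P = Aᵀ * P * (A + B * K) + Q)
    (hK : R * K = -(Bᵀ * P * (A + B * K))) (v : Fin n → ℝ) :
    quad P v = quad P ((A + B * K) *ᵥ v) + stageCost Q R v (K *ᵥ v) := by
  have h1 : quad P v = (A *ᵥ v) ⬝ᵥ (P *ᵥ ((A + B * K) *ᵥ v)) + quad Q v := by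
    conv_lhs => rw [hP]
    rw [quad_add_left, quad]
    simp only [← Matrix.mulVec_mulVec, dotProduct_transpose_mulVec]
  have h2 : quad R (K *ᵥ v) = -((B *ᵥ (K *ᵥ v)) ⬝ᵥ (P *ᵥ ((A + B * K) *ᵥ v))) := by
    rw [quad, Matrix.mulVec_mulVec, hK, Matrix.neg_mulVec, dotProduct_neg]
    simp only [← Matrix.mulVec_mulVec, dotProduct_transpose_mulVec]
  have h3 : quad P ((A + B * K) *ᵥ v) = (A *ᵥ v) ⬝ᵥ (P *ᵥ ((A + B * K) *ᵥ v)) +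
      (B *ᵥ (K *ᵥ v)) ⬝ᵥ (P *ᵥ ((A + B * K) *ᵥ v)) := by
    rw [← add_dotProduct, Matrix.mulVec_mulVec v B K, ← Matrix.add_mulVec A (B * K) v, quad]
  rw [h1, stageCost_eq, h2, h3]
  ring

/-- When P is expanded at (A + BK)v, seen as the perturbed state minus Fv, the term quadratic in F
has the favourable sign. Only the pairing of Fv with the next costate is left. -/
lemma stageCost_perturbed_le (hPsd : P.PosSemidef) (hP : P = Aᵀ * P * (A + B * K) + Q)
    (hK : R * K = -(Bᵀ * P * (A + B * K))) (v : Fin n → ℝ) :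
    stageCost Q R v (K *ᵥ v) ≤ quad P v - quad P ((A + B * K + F) *ᵥ v) +
      2 * (vnorm (F *ᵥ v) * vnorm (P *ᵥ ((A + B * K + F) *ᵥ v))) := by
  have h1 := quad_closedLoop_add hP hK v
  have h2 : (A + B * K) *ᵥ v = (A + B * K + F) *ᵥ v - F *ᵥ v := by
    rw [Matrix.add_mulVec _ F]; simp
  rw [h2, quad_sub_right hPsd.transpose_eq, dotProduct_symm_mulVec hPsd.transpose_eq] at h1
  have h3 := dotProduct_le (F *ᵥ v) (P *ᵥ ((A + B * K + F) *ᵥ v))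
  have h4 := quad_nonneg hPsd (F *ᵥ v)
  linarith

lemma perturbed_sum_le (hPsd : P.PosSemidef) (hP : P = Aᵀ * P * (A + B * K) + Q)
    (hK : R * K = -(Bᵀ * P * (A + B * K))) (hx : ∀ k, x (k + 1) = (A + B * K + F) *ᵥ x k)
    {φ : ℝ} (hF : ‖F‖ ≤ φ) (N : ℕ) :
    ∑ k ∈ Finset.range N, stageCost Q R (x k) (K *ᵥ x k) ≤ quad P (x 0) +
      2 * φ * ∑ k ∈ Finset.range N, vnorm (x k) * vnorm (P *ᵥ x (k + 1)) := by
  suffices h : ∑ k ∈ Finset.range N, stageCost Q R (x k) (K *ᵥ x k) + quad P (x N) ≤ quad P (x 0) +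
      2 * φ * ∑ k ∈ Finset.range N, vnorm (x k) * vnorm (P *ᵥ x (k + 1)) by
    linarith [quad_nonneg hPsd (x N)]
  induction N with
  | zero => simp
  | succ N ih =>
    rw [Finset.sum_range_succ, Finset.sum_range_succ, mul_add]
    have h1 := stageCost_perturbed_le (F := F) hPsd hP hK (x N)
    rw [← hx] at h1
    have h2 := mul_le_mul_of_nonneg_right (vnorm_mulVec_le_of_le hF (x N))
      (vnorm_nonneg (P *ᵥ x (N + 1)))
    linarith

/-- The cost of a policy `K` along a perturbed closed loop. -/
lemma perturbed_cost_le (hc : ControlBounds A B ℓ ν α Γ) (hQR : CostBounds Q R q c s)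
    (hε : 0 ≤ ε) (hA : ‖A₁ - A‖ ≤ ε) (hB : ‖B₁ - B‖ ≤ ε)
    (hPsd : P.PosSemidef) (hPn : ‖P‖ ≤ 2 * Γ) (hKn : ‖K‖ ≤ 2 * Γ)
    (hP : P = A₁ᵀ * P * (A₁ + B₁ * K) + Q) (hK : R * K = -(B₁ᵀ * P * (A₁ + B₁ * K)))
    (hF : ‖F‖ ≤ 3 * Γ * ε) (hsmall : 216 * Γ ^ 4 * s ^ 2 * ε ≤ 1)
    (hx : ∀ k, x (k + 1) = (A₁ + B₁ * K + F) *ᵥ x k) (N : ℕ) :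
    ∑ k ∈ Finset.range N, stageCost Q R (x k) (K *ᵥ x k) ≤
      (1 + 30 * Γ ^ 2 * ((1 + 1 / ν) * ℓ ^ 2 * α ^ 2) * s * ε) * quad P (x 0) := by
  have hΓ := hc.one_le_Γ
  have hs := hQR.one_le_s
  have hν := hc.ν_pos
  have hΓ0 : 0 ≤ Γ := by linarith
  have hs2 : 1 ≤ s ^ 2 := one_le_pow₀ hs
  have hΓ4 : 1 ≤ Γ ^ 4 := one_le_pow₀ hΓ
  have hε1 : ε ≤ 1 := by
    have : 1 ≤ Γ ^ 4 * s ^ 2 := one_le_mul_of_one_le_of_one_le hΓ4 hs2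
    nlinarith
  have hsmall' : 36 * Γ ^ 3 * s * ε ≤ 1 := by
    refine le_trans ?_ hsmall
    gcongr ?_ * ε
    have h1 : Γ ^ 3 ≤ Γ ^ 4 := pow_le_pow_right₀ hΓ (by norm_num)
    have h2 : s ≤ s ^ 2 := by nlinarith
    have h3 : Γ ^ 3 * s ≤ Γ ^ 4 * s ^ 2 := mul_le_mul h1 h2 (by linarith) (by positivity)
    nlinarith [mul_nonneg (pow_nonneg hΓ0 3) (zero_le_one.trans hs)]
  have hA1 : ‖A₁‖ ≤ 2 * Γ := by
    have := norm_add_le A (A₁ - A)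
    rw [add_sub_cancel] at this
    linarith [hc.norm_A_le]
  have hB1 : ‖B₁‖ ≤ 2 * Γ := by
    have := norm_add_le B (B₁ - B)
    rw [add_sub_cancel] at this
    linarith [hc.norm_B_le]
  have hL : ‖A₁ + B₁ * K‖ ≤ 6 * Γ ^ 2 := by
    have h1 := norm_add_le A₁ (B₁ * K)
    have h2 := Matrix.l2_opNorm_mul B₁ K
    have h3 : ‖B₁‖ * ‖K‖ ≤ 2 * Γ * (2 * Γ) := by gcongr
    nlinarith
  have hLF : ‖A₁ + B₁ * K + F‖ ≤ 9 * Γ ^ 2 := by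
    have h1 := norm_add_le (A₁ + B₁ * K) F
    have h2 : 3 * Γ * ε ≤ 3 * Γ ^ 2 := by nlinarith
    linarith
  set C : ℕ → ℝ := fun N => ∑ k ∈ Finset.range N, stageCost Q R (x k) (K *ᵥ x k) with hC
  set lam : ℕ → Fin n → ℝ := fun k => P *ᵥ x k with hlam
  have hv0 : 0 ≤ quad P (x 0) := quad_nonneg hPsd _
  have hcost0 : ∀ k, 0 ≤ stageCost Q R (x k) (K *ᵥ x k) := fun k =>
    stageCost_nonneg hQR.posDef_Q.posSemidef hQR.posDef_R.posSemidef _ _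
  have hxsq : ∀ N, ∑ k ∈ Finset.range N, vnorm (x k) ^ 2 ≤ s ^ 2 * C N := fun N => by
    rw [hC, Finset.mul_sum]
    exact Finset.sum_le_sum fun k _ => hQR.vnorm_sq_le_mul _ _
  have hsum : ∀ N, C N ≤ quad P (x 0) + 6 * Γ * ε *
      ∑ k ∈ Finset.range N, vnorm (x k) * vnorm (lam (k + 1)) := fun N =>
    (perturbed_sum_le hPsd hP hK hx hF N).trans (le_of_eq (by ring))
  -- a priori bound
  have hprior : ∀ N, C N ≤ 2 * quad P (x 0) := fun N => by
    have h1 : ∑ k ∈ Finset.range N, vnorm (x k) * vnorm (lam (k + 1)) ≤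
        18 * Γ ^ 3 * (s ^ 2 * C N) := by
      refine le_trans (Finset.sum_le_sum (g := fun k => 18 * Γ ^ 3 * vnorm (x k) ^ 2)
        fun k _ => ?_) ?_
      · have h2 : vnorm (lam (k + 1)) ≤ 2 * Γ * (9 * Γ ^ 2 * vnorm (x k)) := by
          refine (vnorm_mulVec_le_of_le hPn _).trans ?_
          gcongr
          rw [hx]
          exact vnorm_mulVec_le_of_le hLF _
        have := mul_le_mul_of_nonneg_left h2 (vnorm_nonneg (x k))
        linarith
      · rw [← Finset.mul_sum]
        exact mul_le_mul_of_nonneg_left (hxsq N) (by positivity)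
    have h2 := hsum N
    -- The constant 216 = 2 · 6 · 18 in `hsmall` lets half of the cost absorb the cross term.
    have h3 : 6 * Γ * ε * (18 * Γ ^ 3 * (s ^ 2 * C N)) ≤ 1 / 2 * C N := by
      have h4 : 0 ≤ C N := Finset.sum_nonneg fun k _ => hcost0 k
      have h5 := mul_le_mul_of_nonneg_right hsmall h4
      linarith
    have h6 : 6 * Γ * ε * ∑ k ∈ Finset.range N, vnorm (x k) * vnorm (lam (k + 1)) ≤
        6 * Γ * ε * (18 * Γ ^ 3 * (s ^ 2 * C N)) := by gcongr
    linarith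
  -- residuals of the costate recursion
  set a : ℕ → Fin n → ℝ := fun k => lam k - Aᵀ *ᵥ lam (k + 1) with ha
  set b : ℕ → Fin d → ℝ := fun k => Bᵀ *ᵥ lam (k + 1) with hb
  have hlam1 : ∀ k, lam (k + 1) = P *ᵥ ((A₁ + B₁ * K) *ᵥ x k) + P *ᵥ (F *ᵥ x k) := fun k => by
    rw [← Matrix.mulVec_add, ← Matrix.add_mulVec, ← hx]
  have hPL : ∀ k, vnorm (P *ᵥ ((A₁ + B₁ * K) *ᵥ x k)) ≤ 12 * Γ ^ 3 * vnorm (x k) := fun k => by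
    refine (vnorm_mulVec_le_of_le hPn _).trans ?_
    have := mul_le_mul_of_nonneg_left (vnorm_mulVec_le_of_le hL (x k)) (by linarith : 0 ≤ 2 * Γ)
    linarith
  have hPF : ∀ k, vnorm (P *ᵥ (F *ᵥ x k)) ≤ 6 * Γ ^ 2 * ε * vnorm (x k) := fun k => by
    refine (vnorm_mulVec_le_of_le hPn _).trans ?_
    have := mul_le_mul_of_nonneg_left (vnorm_mulVec_le_of_le hF (x k)) (by linarith : 0 ≤ 2 * Γ)
    linarith
  have hAt : ‖Aᵀ‖ ≤ Γ := by rw [norm_transpose]; exact hc.norm_A_le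
  have hBt : ‖Bᵀ‖ ≤ Γ := by rw [norm_transpose]; exact hc.norm_B_le
  have hdA : ‖(A₁ - A)ᵀ‖ ≤ ε := by rwa [norm_transpose]
  have hdB : ‖(B₁ - B)ᵀ‖ ≤ ε := by rwa [norm_transpose]
  have hbound : ∀ k, ε * (12 * Γ ^ 3 * vnorm (x k)) + Γ * (6 * Γ ^ 2 * ε * vnorm (x k)) =
      18 * Γ ^ 3 * ε * vnorm (x k) := fun k => by ring
  -- Without perturbation Pontryagin's equations give exactly Qx_k here and -RKx_k for b; replacing
  -- A₁, B₁ by A, B and adding F contributes O(ε) terms.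
  have hak : ∀ k, vnorm (a k) ≤ vnorm (Q *ᵥ x k) + 18 * Γ ^ 3 * ε * vnorm (x k) := fun k => by
    have h1 : a k = Q *ᵥ x k + ((A₁ - A)ᵀ *ᵥ (P *ᵥ ((A₁ + B₁ * K) *ᵥ x k)) -
        Aᵀ *ᵥ (P *ᵥ (F *ᵥ x k))) := by
      have h2 : lam k = A₁ᵀ *ᵥ (P *ᵥ ((A₁ + B₁ * K) *ᵥ x k)) + Q *ᵥ x k := by
        simp only [hlam]
        conv_lhs => rw [hP]
        simp only [Matrix.add_mulVec _ Q, ← Matrix.mulVec_mulVec]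
      rw [ha]
      simp only
      rw [h2, hlam1, Matrix.mulVec_add, Matrix.transpose_sub, Matrix.sub_mulVec]
      abel
    rw [h1, ← hbound]
    refine (vnorm_add_le _ _).trans (add_le_add_right ((vnorm_sub_le _ _).trans ?_) _)
    exact add_le_add
      ((vnorm_mulVec_le_of_le hdA _).trans (mul_le_mul_of_nonneg_left (hPL k) hε))
      ((vnorm_mulVec_le_of_le hAt _).trans (mul_le_mul_of_nonneg_left (hPF k) hΓ0))
  have hbk : ∀ k, vnorm (b k) ≤ vnorm (R *ᵥ (K *ᵥ x k)) + 18 * Γ ^ 3 * ε * vnorm (x k) := fun k => by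
    have h1 : b k = -(R *ᵥ (K *ᵥ x k)) - ((B₁ - B)ᵀ *ᵥ (P *ᵥ ((A₁ + B₁ * K) *ᵥ x k)) -
        Bᵀ *ᵥ (P *ᵥ (F *ᵥ x k))) := by
      have h2 : R *ᵥ (K *ᵥ x k) = -(B₁ᵀ *ᵥ (P *ᵥ ((A₁ + B₁ * K) *ᵥ x k))) := by
        rw [Matrix.mulVec_mulVec, hK]
        simp only [Matrix.neg_mulVec, ← Matrix.mulVec_mulVec]
      rw [hb]
      simp only
      rw [h2, hlam1, Matrix.mulVec_add, Matrix.transpose_sub, Matrix.sub_mulVec]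
      abel
    rw [h1, ← hbound]
    refine (vnorm_sub_le _ _).trans ?_
    rw [vnorm_neg]
    refine add_le_add_right ((vnorm_sub_le _ _).trans ?_) _
    exact add_le_add
      ((vnorm_mulVec_le_of_le hdB _).trans (mul_le_mul_of_nonneg_left (hPL k) hε))
      ((vnorm_mulVec_le_of_le hBt _).trans (mul_le_mul_of_nonneg_left (hPF k) hΓ0))
  have hg : ∀ k, (vnorm (a k) + vnorm (b k)) ^ 2 ≤ 6 * c * stageCost Q R (x k) (K *ᵥ x k) :=
    fun k => by
    set y := vnorm (Q *ᵥ x k)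
    set z := vnorm (R *ᵥ (K *ᵥ x k))
    set w := 36 * Γ ^ 3 * ε * vnorm (x k) with hw
    have h1 : vnorm (a k) + vnorm (b k) ≤ y + z + w := by
      rw [hw]; linarith [hak k, hbk k]
    have h2 : y ^ 2 + z ^ 2 ≤ c * stageCost Q R (x k) (K *ᵥ x k) := hQR.mulVec_sq_add_le _ _
    have h3 : w ^ 2 ≤ c * stageCost Q R (x k) (K *ᵥ x k) :=
      calc w ^ 2 = (36 * Γ ^ 3 * ε) ^ 2 * vnorm (x k) ^ 2 := by rw [hw]; ring
        _ ≤ (36 * Γ ^ 3 * ε) ^ 2 * (s ^ 2 * stageCost Q R (x k) (K *ᵥ x k)) := by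
          gcongr; exact hQR.vnorm_sq_le_mul _ _
        _ = (36 * Γ ^ 3 * s * ε) ^ 2 * stageCost Q R (x k) (K *ᵥ x k) := by ring
        _ ≤ 1 ^ 2 * stageCost Q R (x k) (K *ᵥ x k) := by
          gcongr
          exact hcost0 k
        _ ≤ c * stageCost Q R (x k) (K *ᵥ x k) := by
          gcongr
          · exact hcost0 k
          · simpa using hQR.one_le_c
    have h4 : (vnorm (a k) + vnorm (b k)) ^ 2 ≤ (y + z + w) ^ 2 := by
      have := vnorm_nonneg (a k)
      have := vnorm_nonneg (b k)
      gcongr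
    nlinarith [sq_nonneg (y - z), sq_nonneg (y - w), sq_nonneg (z - w)]
  -- Needed at every horizon, because the windows below reach beyond N.
  have hgsum : ∀ N, ∑ k ∈ Finset.range N, (vnorm (a k) + vnorm (b k)) ^ 2 ≤
      12 * c * quad P (x 0) := fun N => by
    refine (Finset.sum_le_sum fun k _ => hg k).trans ?_
    rw [← Finset.mul_sum]
    have := mul_le_mul_of_nonneg_left (hprior N)
      (by linarith [hQR.one_le_c] : 0 ≤ 6 * c)
    linarith
  -- observation of the costate
  set Z := (1 + 1 / ν) * ℓ * Γ * α ^ 2 with hZ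
  have hZ0 : 0 ≤ Z := by positivity
  have hlamk : ∀ k, vnorm (lam (k + 1)) ≤
      Z * ∑ i ∈ Finset.range ℓ, (vnorm (a (k + i)) + vnorm (b (k + i))) := fun k =>
    vnorm_costate_le hc.ctrl hν hc.one_le_ℓ hc.one_le_α hc.norm_pow_le hΓ hc.norm_B_le
      (fun k => by simp [ha]) (fun k => rfl) k
  have hlamsum : ∑ k ∈ Finset.range N, vnorm (lam (k + 1)) ^ 2 ≤
      Z ^ 2 * (ℓ ^ 2 * (12 * c * quad P (x 0))) := by
    refine le_trans (Finset.sum_le_sum (g := fun k =>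
      Z ^ 2 * (∑ i ∈ Finset.range ℓ, (vnorm (a (k + i)) + vnorm (b (k + i)))) ^ 2) fun k _ => ?_) ?_
    · rw [← mul_pow]
      have := vnorm_nonneg (lam (k + 1))
      gcongr
      exact hlamk k
    · rw [← Finset.mul_sum]
      gcongr
      refine (sum_window_sq_le (g := fun k => vnorm (a k) + vnorm (b k)) ℓ N).trans ?_
      gcongr
      exact hgsum _
  -- The state energy carries 1/q and the costate energy carries c, so Cauchy-Schwarz leaves √(c/q)
  -- ≤ s, one power of s instead of the two of the a priori bound.
  have hcs : ∑ k ∈ Finset.range N, vnorm (x k) * vnorm (lam (k + 1)) ≤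
      5 * s * Z * ℓ * quad P (x 0) := by
    have hq := hQR.q_pos
    have hxq : ∑ k ∈ Finset.range N, vnorm (x k) ^ 2 ≤ 2 * quad P (x 0) / q := by
      rw [le_div_iff₀ hq, mul_comm, Finset.mul_sum]
      refine (Finset.sum_le_sum fun k _ => ?_).trans (hprior N)
      rw [stageCost_eq]
      linarith [hQR.le_quad (x k), quad_nonneg hQR.posDef_R.posSemidef (K *ᵥ x k)]
    refine sum_mul_le_of_sq_le (by positivity) hxq hlamsum ?_
    have h1 : c / q ≤ s ^ 2 := (div_le_iff₀ hq).2 hQR.le_s_sq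
    have h2 : 0 ≤ c / q := div_nonneg (by linarith [hQR.one_le_c]) hq.le
    calc 2 * quad P (x 0) / q * (Z ^ 2 * (ℓ ^ 2 * (12 * c * quad P (x 0))))
        = 24 * (Z * ℓ * quad P (x 0)) ^ 2 * (c / q) := by ring
      _ ≤ 25 * (Z * ℓ * quad P (x 0)) ^ 2 * s ^ 2 := by gcongr; norm_num
      _ = (5 * s * Z * ℓ * quad P (x 0)) ^ 2 := by ring
  have hfin := hsum N
  have hfin2 : 6 * Γ * ε * ∑ k ∈ Finset.range N, vnorm (x k) * vnorm (lam (k + 1)) ≤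
      6 * Γ * ε * (5 * s * Z * ℓ * quad P (x 0)) := by gcongr
  refine (hfin.trans (add_le_add_right hfin2 _)).trans (le_of_eq ?_)
  rw [hZ]; ring

end PerturbedCost

/-! ### Perturbation of the Riccati solution and of the gain -/

section RiccatiPerturbation

variable {n d ℓ : ℕ} {A A' : Matrix (Fin n) (Fin n) ℝ} {B B' : Matrix (Fin n) (Fin d) ℝ}
  {Q P : Matrix (Fin n) (Fin n) ℝ} {R : Matrix (Fin d) (Fin d) ℝ}
  {ν α Γ q c s ε : ℝ}

lemma IsDareSolution.eq_closedLoop (h : IsDareSolution A B Q R P) :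
    P = Aᵀ * P * (A + B * greedyGain A B R P) + Q := by
  conv_lhs => rw [← h.riccatiMap_eq, LQR.riccatiMap_eq]

/-- The input cost is part of the value and R ≥ I; hence the gain is bounded by the square root of
‖P‖, with no inverse to estimate. -/
lemma IsDareSolution.norm_greedyGain_sq_le (h : IsDareSolution A B Q R P)
    (hQR : CostBounds Q R q c s) (v : Fin n → ℝ) :
    vnorm (greedyGain A B R P *ᵥ v) ^ 2 ≤ quad P v := by
  have h1 := quad_closedLoop_add h.eq_closedLoop (R_mul_greedyGain hQR.posDef_R h.posSemidef) v
  have h2 := hQR.vnorm_sq_le (greedyGain A B R P *ᵥ v)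
  have h3 := quad_nonneg h.posSemidef ((A + B * greedyGain A B R P) *ᵥ v)
  have h4 := quad_nonneg hQR.posDef_Q.posSemidef v
  rw [stageCost_eq] at h1
  linarith

lemma norm_add_mul_sub_le {K : Matrix (Fin d) (Fin n) ℝ} {g : ℝ} (hA : ‖A' - A‖ ≤ ε)
    (hB : ‖B' - B‖ ≤ ε) (hK : ‖K‖ ≤ g) : ‖(A' - A) + (B' - B) * K‖ ≤ (1 + g) * ε := by
  have h1 := norm_add_le (A' - A) ((B' - B) * K)
  have h2 := Matrix.l2_opNorm_mul (B' - B) K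
  have h3 : ‖B' - B‖ * ‖K‖ ≤ ε * g := mul_le_mul hB hK (norm_nonneg _) ((norm_nonneg _).trans hB)
  linarith

/-- The certainty equivalent controller exists and is close to the optimal one. -/
lemma IsDareSolution.perturbation (hc : ControlBounds A B ℓ ν α Γ) (hQR : CostBounds Q R q c s)
    (h : IsDareSolution A B Q R P) (hPn : ‖P‖ ≤ Γ) (hKn : 1 + ‖greedyGain A B R P‖ ≤ Γ)
    (hε : 0 ≤ ε) (hA : ‖A' - A‖ ≤ ε) (hB : ‖B' - B‖ ≤ ε)
    (hsmall : 216 * Γ ^ 4 * s ^ 2 * ε ≤ 1)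
    (hsmall' : 30 * Γ ^ 2 * ((1 + 1 / ν) * ℓ ^ 2 * α ^ 2) * s * ε ≤ 1) :
    (∃! P', IsDareSolution A' B' Q R P') ∧ ∀ P', IsDareSolution A' B' Q R P' →
      ‖(R + Bᵀ * P * B) * (greedyGain A' B' R P' - greedyGain A B R P)‖ ≤
        375 * Γ ^ 6 * ((1 + 1 / ν) * ℓ ^ 2 * α ^ 2) * s * ε := by
  have hΓ := hc.one_le_Γ
  have hs := hQR.one_le_s
  have hν := hc.ν_pos
  set X := (1 + 1 / ν) * (ℓ : ℝ) ^ 2 * α ^ 2 with hX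
  set δ := 30 * Γ ^ 2 * X * s * ε with hδ
  have hX0 : 1 ≤ X := by
    have h1 : (1 : ℝ) ≤ 1 + 1 / ν := by have := one_div_pos.2 hν; linarith
    have h2 : (1 : ℝ) ≤ (ℓ : ℝ) ^ 2 := one_le_pow₀ (by exact_mod_cast hc.one_le_ℓ)
    have h3 : (1 : ℝ) ≤ α ^ 2 := one_le_pow₀ hc.one_le_α
    exact one_le_mul_of_one_le_of_one_le (one_le_mul_of_one_le_of_one_le h1 h2) h3
  have hδ0 : 0 ≤ δ := by positivity
  set K := greedyGain A B R P with hK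
  -- the optimal controller on the perturbed system
  have hfwd : ∀ v N, ∑ k ∈ Finset.range N, stageCost Q R ((A' + B' * K) ^ k *ᵥ v)
      (K *ᵥ ((A' + B' * K) ^ k *ᵥ v)) ≤ (1 + δ) * quad P v := fun v N => by
    have hF := norm_add_mul_sub_le hA hB (g := Γ) (by linarith : ‖K‖ ≤ Γ)
    -- The Riccati data are those of the true pair, so the whole perturbation sits in F.
    have := perturbed_cost_le (F := (A' - A) + (B' - B) * K)
      (x := fun k => (A' + B' * K) ^ k *ᵥ v) hc hQR hε (A₁ := A) (B₁ := B)
      (by simpa using hε) (by simpa using hε) h.posSemidef (by linarith) (by linarith)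
      h.eq_closedLoop (R_mul_greedyGain hQR.posDef_R h.posSemidef)
      (hF.trans (by gcongr; linarith)) hsmall (fun k => ?_) N
    · simp only [pow_zero, Matrix.one_mulVec] at this
      exact this
    · simp only [pow_succ', ← Matrix.mulVec_mulVec]
      rw [← hK, show A + B * K + (A' - A + (B' - B) * K) = A' + B' * K by
        rw [Matrix.sub_mul]; abel]
  have hstep : ∀ (M : Matrix (Fin n) (Fin n) ℝ) (N : Matrix (Fin n) (Fin d) ℝ)
      (G : Matrix (Fin d) (Fin n) ℝ) (v : Fin n → ℝ) (k : ℕ), (M + N * G) ^ (k + 1) *ᵥ v =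
      M *ᵥ ((M + N * G) ^ k *ᵥ v) + N *ᵥ (G *ᵥ ((M + N * G) ^ k *ᵥ v)) := fun M N G v k => by
    rw [pow_succ', ← Matrix.mulVec_mulVec, Matrix.add_mulVec, Matrix.mulVec_mulVec _ N]
  have hex : ∃! P', IsDareSolution A' B' Q R P' :=
    existsUnique_isDareSolution hQR.posDef_Q hQR.posDef_R fun v =>
      ⟨_, fun k => (A' + B' * K) ^ k *ᵥ v, fun k => K *ᵥ ((A' + B' * K) ^ k *ᵥ v), by simp,
        hstep A' B' K v, hfwd v⟩
  refine ⟨hex, fun P' h' => ?_⟩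
  have hup : ∀ v, quad P' v ≤ (1 + δ) * quad P v := fun v => by
    have := h'.quad_le_of_sum_le hQR.posDef_Q hQR.posDef_R (hstep A' B' K v) (hfwd v)
    simpa using this
  have hPv : ∀ v, quad P v ≤ Γ * vnorm v ^ 2 := quad_le_of_norm_le hPn
  have hP'v : ∀ v, quad P' v ≤ 2 * Γ * vnorm v ^ 2 := fun v => by
    have h1 := hup v
    have h2 := mul_le_mul_of_nonneg_right (by linarith : 1 + δ ≤ 2) (quad_nonneg h.posSemidef v)
    linarith [hPv v]
  have hP'n : ‖P'‖ ≤ 2 * Γ := norm_le_of_abs_quad_le h'.posSemidef.transpose_eq (by linarith)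
    fun v => by rw [abs_of_nonneg (quad_nonneg h'.posSemidef v)]; exact hP'v v
  set K' := greedyGain A' B' R P' with hK'
  have hK'n : ‖K'‖ ≤ 2 * Γ := norm_le_of_vnorm_le (by linarith) fun v => by
    have h1 := (h'.norm_greedyGain_sq_le hQR v).trans (hP'v v)
    have := vnorm_nonneg v
    refine le_of_sq_le_sq (h1.trans ?_) (by positivity)
    rw [mul_pow]
    gcongr
    nlinarith
  have hF' : ‖(A - A') + (B - B') * K'‖ ≤ 3 * Γ * ε :=
    (norm_add_mul_sub_le ((norm_sub_rev _ _).trans_le hA) ((norm_sub_rev _ _).trans_le hB) hK'n).trans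
      (by gcongr; linarith)
  -- the certainty equivalent controller on the true system
  have hbwd : ∀ v N, ∑ k ∈ Finset.range N, stageCost Q R ((A + B * K') ^ k *ᵥ v)
      (K' *ᵥ ((A + B * K') ^ k *ᵥ v)) ≤ (1 + δ) * quad P' v := fun v N => by
    -- Now the Riccati data are those of the estimates, while the controllability bounds remain
    -- those of the true pair.
    have := perturbed_cost_le (F := (A - A') + (B - B') * K')
      (x := fun k => (A + B * K') ^ k *ᵥ v) hc hQR hε hA hB h'.posSemidef hP'n hK'n
      h'.eq_closedLoop (R_mul_greedyGain hQR.posDef_R h'.posSemidef) hF' hsmall (fun k => ?_) N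
    · simp only [pow_zero, Matrix.one_mulVec] at this
      exact this
    · simp only [pow_succ', ← Matrix.mulVec_mulVec]
      rw [show A' + B' * K' + (A - A' + (B - B') * K') = A + B * K' by
        rw [Matrix.sub_mul]; abel]
  have hlow : ∀ v, quad P v ≤ (1 + δ) * quad P' v := fun v => by
    have := h.quad_le_of_sum_le hQR.posDef_Q hQR.posDef_R (hstep A B K' v) (hbwd v)
    simpa using this
  have hD : ‖P - P'‖ ≤ 2 * Γ * δ := by
    refine norm_le_of_abs_quad_le ?_ (by positivity) fun v => ?_
    · rw [Matrix.transpose_sub, h.posSemidef.transpose_eq, h'.posSemidef.transpose_eq]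
    · rw [quad_sub_left, abs_le]
      have h1 := mul_le_mul_of_nonneg_left (hPv v) hδ0
      have h2 := mul_le_mul_of_nonneg_left (hP'v v) hδ0
      have h3 := mul_nonneg hδ0 (mul_nonneg (zero_le_one.trans hΓ) (sq_nonneg (vnorm v)))
      constructor <;> linarith [hup v, hlow v]
  have hε1 : ε ≤ 1 := by
    have : 1 ≤ Γ ^ 4 * s ^ 2 :=
      one_le_mul_of_one_le_of_one_le (one_le_pow₀ hΓ) (one_le_pow₀ hs)
    nlinarith
  have hA'n : ‖A'‖ ≤ 2 * Γ := by
    have := norm_add_le A (A' - A)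
    rw [add_sub_cancel] at this
    linarith [hc.norm_A_le]
  have hB'n : ‖B'‖ ≤ 2 * Γ := by
    have := norm_add_le B (B' - B)
    rw [add_sub_cancel] at this
    linarith [hc.norm_B_le]
  have hL' : ‖A' + B' * K'‖ ≤ 6 * Γ ^ 2 := by
    have h1 := norm_add_le A' (B' * K')
    have h2 := Matrix.l2_opNorm_mul B' K'
    have h3 : ‖B'‖ * ‖K'‖ ≤ 2 * Γ * (2 * Γ) := by gcongr
    nlinarith
  have hBt : ‖Bᵀ‖ ≤ Γ := by rw [norm_transpose]; exact hc.norm_B_le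
  have hdB : ‖(B - B')ᵀ‖ ≤ ε := by rwa [norm_transpose, norm_sub_rev]
  -- The left side equals BᵀP(A + BK') - B'ᵀP'(A' + B'K'), telescoped one factor at a time. Keeping
  -- the factor R + BᵀPB avoids both its inverse and its norm.
  have hW : (R + Bᵀ * P * B) * (K' - K) = Bᵀ * ((P - P') * (A' + B' * K')) +
      Bᵀ * (P * ((A - A') + (B - B') * K')) + (B - B')ᵀ * (P' * (A' + B' * K')) := by
    have h1 := mul_greedyGain (A := A) (B := B) hQR.posDef_R h.posSemidef
    have h2 := R_mul_greedyGain (A := A') (B := B') hQR.posDef_R h'.posSemidef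
    rw [← hK] at h1
    rw [← hK'] at h2
    rw [Matrix.mul_sub, h1, Matrix.add_mul, h2]
    simp only [Matrix.transpose_sub, Matrix.mul_add, Matrix.mul_sub, Matrix.sub_mul,
      Matrix.mul_assoc]
    abel
  have mul3 : ∀ {k l m o : ℕ} (M₁ : Matrix (Fin k) (Fin l) ℝ) (M₂ : Matrix (Fin l) (Fin m) ℝ)
      (M₃ : Matrix (Fin m) (Fin o) ℝ) {a b e : ℝ}, ‖M₁‖ ≤ a → ‖M₂‖ ≤ b → ‖M₃‖ ≤ e →
      ‖M₁ * (M₂ * M₃)‖ ≤ a * (b * e) := by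
    intro k l m o M₁ M₂ M₃ a b e h1 h2 h3
    have ha := (norm_nonneg _).trans h1
    have hb := (norm_nonneg _).trans h2
    refine (Matrix.l2_opNorm_mul _ _).trans
      (mul_le_mul h1 ((Matrix.l2_opNorm_mul _ _).trans ?_) (norm_nonneg _) ha)
    exact mul_le_mul h2 h3 (norm_nonneg _) hb
  rw [hW]
  have t1 := mul3 _ _ _ hBt hD hL'
  have t2 := mul3 _ _ _ hBt hPn hF'
  have t3 := mul3 _ _ _ hdB hP'n hL'
  have hXs : 1 ≤ X * s := one_le_mul_of_one_le_of_one_le hX0 hs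
  have hΓ3 : Γ ^ 3 * ε ≤ Γ ^ 6 * X * s * ε := by
    have h1 : Γ ^ 3 ≤ Γ ^ 6 := pow_le_pow_right₀ hΓ (by norm_num)
    have h2 : Γ ^ 6 ≤ Γ ^ 6 * (X * s) := le_mul_of_one_le_right (by positivity) hXs
    calc Γ ^ 3 * ε ≤ Γ ^ 6 * (X * s) * ε := by gcongr; linarith
      _ = _ := by ring
  refine (norm_add₃_le).trans ?_
  calc _ ≤ Γ * (2 * Γ * δ * (6 * Γ ^ 2)) + Γ * (Γ * (3 * Γ * ε)) + ε * (2 * Γ * (6 * Γ ^ 2)) := by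
        linarith
    _ = 360 * (Γ ^ 6 * X * s * ε) + 15 * (Γ ^ 3 * ε) := by rw [hδ]; ring
    _ ≤ _ := by linarith

end RiccatiPerturbation

/-! ### Energy gains and stability of a perturbed closed loop -/

section SmallGain

variable {n d : ℕ} {L P : Matrix (Fin n) (Fin n) ℝ} {z f h g : ℕ → Fin n → ℝ} {τ γ Γ q : ℝ}

lemma sum_response_le_of_norm_pow_le (hL : ∀ k, ‖L ^ k‖ ≤ τ * γ ^ k) (hγ : 0 ≤ γ)
    (hγ1 : γ < 1) (hz0 : z 0 = 0) (hz : ∀ k, z (k + 1) = Lᵀ *ᵥ z k + f k) (N : ℕ) :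
    ∑ k ∈ Finset.range N, vnorm (z k) ^ 2 ≤
      (τ / (1 - γ)) ^ 2 * ∑ k ∈ Finset.range N, vnorm (f k) ^ 2 := by
  have hγ' : 0 < 1 - γ := by linarith
  -- A scalar majorant. The induction below bounds all (Lᵀ)^m z_k at once, so that τ enters once per
  -- input and does not compound.
  let r : ℕ → ℝ := fun k => Nat.rec 0 (fun j t => γ * t + τ * vnorm (f j)) k
  have hr0 : r 0 = 0 := rfl
  have hr : ∀ k, r (k + 1) = γ * r k + τ * vnorm (f k) := fun k => rfl
  have hzr : ∀ k m, vnorm (Lᵀ ^ m *ᵥ z k) ≤ γ ^ m * r k := fun k => by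
    induction k with
    | zero => intro m; simp [hz0, hr0]
    | succ k ih =>
      intro m
      rw [hz, Matrix.mulVec_add, Matrix.mulVec_mulVec, ← pow_succ, hr]
      refine (vnorm_add_le _ _).trans ?_
      have h1 := ih (m + 1)
      have h2 := vnorm_transpose_pow_mulVec_le (hL m) (f k)
      have h3 : γ ^ (m + 1) * r k = γ ^ m * (γ * r k) := by ring
      linarith
  have hsum : ∀ N, (1 - γ) * ∑ k ∈ Finset.range N, r k ^ 2 + r N ^ 2 ≤
      τ ^ 2 / (1 - γ) * ∑ k ∈ Finset.range N, vnorm (f k) ^ 2 := fun N => by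
    induction N with
    | zero => simp [hr0]
    | succ N ih =>
      rw [Finset.sum_range_succ, Finset.sum_range_succ, mul_add, mul_add]
      -- Convexity of the square at γ r + (1 - γ) t.
      have h1 : r (N + 1) ^ 2 ≤ γ * r N ^ 2 + τ ^ 2 / (1 - γ) * vnorm (f N) ^ 2 := by
        obtain ⟨t, ht⟩ : ∃ t, τ * vnorm (f N) = (1 - γ) * t :=
          ⟨τ * vnorm (f N) / (1 - γ), by field_simp⟩
        have h2 : τ ^ 2 / (1 - γ) * vnorm (f N) ^ 2 = (1 - γ) * t ^ 2 := by
          rw [div_mul_eq_mul_div, ← mul_pow, ht]; field_simp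
        rw [h2, hr, ht]
        nlinarith [mul_nonneg (mul_nonneg hγ hγ'.le) (sq_nonneg (r N - t))]
      linarith
  have h1 : ∑ k ∈ Finset.range N, vnorm (z k) ^ 2 ≤ ∑ k ∈ Finset.range N, r k ^ 2 :=
    Finset.sum_le_sum fun k _ => by
      have h2 := hzr k 0
      simp only [pow_zero, Matrix.one_mulVec, one_mul] at h2
      exact pow_le_pow_left₀ (vnorm_nonneg _) h2 2
  refine h1.trans ?_
  have h2 := hsum N
  have h3 : (τ / (1 - γ)) ^ 2 * ∑ k ∈ Finset.range N, vnorm (f k) ^ 2 =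
      (τ ^ 2 / (1 - γ) * ∑ k ∈ Finset.range N, vnorm (f k) ^ 2) / (1 - γ) := by
    field_simp
  rw [h3, le_div_iff₀ hγ']
  linarith [sq_nonneg (r N)]

/-- P serves as a storage function: each step loses part of q|h|² and gains a multiple of |g|², and
summation telescopes. -/
lemma sum_response_le_of_lyapunov (hP : P.PosSemidef) (hPn : ‖P‖ ≤ Γ) (hq : 0 < q) (hqΓ : q ≤ Γ)
    (hL : ∀ v, quad P (L *ᵥ v) + q * vnorm v ^ 2 ≤ quad P v)
    (hh0 : h 0 = 0) (hh : ∀ k, h (k + 1) = L *ᵥ h k + g k) (N : ℕ) :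
    ∑ k ∈ Finset.range N, vnorm (h k) ^ 2 ≤
      6 * (Γ / q) ^ 2 * ∑ k ∈ Finset.range N, vnorm (g k) ^ 2 := by
  have hΓ : 0 < Γ := hq.trans_le hqΓ
  have hstep : ∀ x y : Fin n → ℝ, quad P (L *ᵥ x + y) ≤
      quad P x - q / 2 * vnorm x ^ 2 + 3 * Γ ^ 2 / q * vnorm y ^ 2 := fun x y => by
    -- With this weight in Young's inequality the cross term uses up half of the decrease q|x|².
    set θ := q / (2 * Γ) with hθ
    have hθ0 : 0 < θ := by positivity
    have h1 := quad_nonneg hP (θ • (L *ᵥ x) - y)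
    rw [quad_sub_right hP.transpose_eq, quad_smul_right, smul_dotProduct, smul_eq_mul] at h1
    have h2 : 2 * ((L *ᵥ x) ⬝ᵥ (P *ᵥ y)) ≤ θ * quad P (L *ᵥ x) + quad P y / θ := by
      rw [← sub_nonneg]
      have : θ * quad P (L *ᵥ x) + quad P y / θ - 2 * ((L *ᵥ x) ⬝ᵥ (P *ᵥ y)) =
        (θ ^ 2 * quad P (L *ᵥ x) - 2 * (θ * ((L *ᵥ x) ⬝ᵥ (P *ᵥ y))) + quad P y) / θ := by
        field_simp
        ring
      rw [this]; positivity
    have h3 := hL x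
    have h4 : θ * quad P (L *ᵥ x) ≤ q / 2 * vnorm x ^ 2 := by
      have h5 : quad P (L *ᵥ x) ≤ Γ * vnorm x ^ 2 := by
        have := quad_le_of_norm_le hPn x
        nlinarith [sq_nonneg (vnorm x)]
      calc θ * quad P (L *ᵥ x) ≤ θ * (Γ * vnorm x ^ 2) := by gcongr
        _ = _ := by rw [hθ]; field_simp
    have h6 : quad P y + quad P y / θ ≤ 3 * Γ ^ 2 / q * vnorm y ^ 2 := by
      have h7 : quad P y + quad P y / θ = (1 + 2 * Γ / q) * quad P y := by
        rw [hθ]; field_simp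
      have h8 : 1 ≤ Γ / q := (one_le_div hq).2 hqΓ
      have h9 := quad_le_of_norm_le hPn y
      calc _ ≤ (3 * (Γ / q)) * (Γ * vnorm y ^ 2) := by
            rw [h7]
            refine mul_le_mul ?_ h9 (quad_nonneg hP y) (by positivity)
            rw [mul_div_assoc]; linarith
        _ = _ := by field_simp
    rw [quad_add_right hP.transpose_eq]
    linarith
  have hsum : ∀ N, q / 2 * ∑ k ∈ Finset.range N, vnorm (h k) ^ 2 + quad P (h N) ≤
      3 * Γ ^ 2 / q * ∑ k ∈ Finset.range N, vnorm (g k) ^ 2 := fun N => by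
    induction N with
    | zero => simp [hh0]
    | succ N ih =>
      rw [Finset.sum_range_succ, Finset.sum_range_succ, mul_add, mul_add, hh]
      linarith [hstep (h N) (g N)]
  have h1 := hsum N
  have h2 := quad_nonneg hP (h N)
  have h3 : 6 * (Γ / q) ^ 2 * ∑ k ∈ Finset.range N, vnorm (g k) ^ 2 =
      (3 * Γ ^ 2 / q * ∑ k ∈ Finset.range N, vnorm (g k) ^ 2) / (q / 2) := by
    field_simp; ring
  rw [h3, le_div_iff₀ (by positivity)]
  linarith

/-- The transposed system has the same energy gain, by duality. -/
lemma sum_dual_response_le_of_lyapunov (hP : P.PosSemidef) (hPn : ‖P‖ ≤ Γ) (hq : 0 < q)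
    (hqΓ : q ≤ Γ) (hL : ∀ v, quad P (L *ᵥ v) + q * vnorm v ^ 2 ≤ quad P v)
    (hz0 : z 0 = 0) (hz : ∀ k, z (k + 1) = Lᵀ *ᵥ z k + f k) (N : ℕ) :
    ∑ k ∈ Finset.range N, vnorm (z k) ^ 2 ≤
      6 * (Γ / q) ^ 2 * ∑ k ∈ Finset.range N, vnorm (f k) ^ 2 := by
  -- The adjoint system, driven by z in reversed time; pairing it with z telescopes Σ|z|² into Σ f ·
  -- h.
  let h : ℕ → Fin n → ℝ := fun k => Nat.rec 0 (fun j t => L *ᵥ t + z (N - 1 - j)) k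
  have hh0 : h 0 = 0 := rfl
  have hh : ∀ k, h (k + 1) = L *ᵥ h k + z (N - 1 - k) := fun k => rfl
  have htel : ∀ m ≤ N, ∑ k ∈ Finset.range m, vnorm (z k) ^ 2 + z m ⬝ᵥ h (N - m) =
      ∑ k ∈ Finset.range m, f k ⬝ᵥ h (N - 1 - k) := fun m => by
    induction m with
    | zero => simp [hz0]
    | succ m ih =>
      intro hm
      rw [Finset.sum_range_succ, Finset.sum_range_succ, ← ih (by omega)]
      have h1 : N - m = (N - 1 - m) + 1 := by omega
      have h2 : N - (m + 1) = N - 1 - m := by omega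
      have h3 : N - 1 - (N - 1 - m) = m := by omega
      rw [h1, h2, hh, h3, hz, vnorm_sq, add_dotProduct, dotProduct_add, dotProduct_comm (Lᵀ *ᵥ z m),
        dotProduct_transpose_mulVec, dotProduct_comm (L *ᵥ _)]
      ring
  have h1 := htel N le_rfl
  rw [Nat.sub_self, hh0, dotProduct_zero, add_zero] at h1
  have h2 := sum_response_le_of_lyapunov hP hPn hq hqΓ hL hh0 hh N
  rw [Finset.sum_range_reflect (fun k => vnorm (z k) ^ 2)] at h2
  set S := ∑ k ∈ Finset.range N, vnorm (z k) ^ 2 with hS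
  set Φ := ∑ k ∈ Finset.range N, vnorm (f k) ^ 2 with hΦ
  have hS0 : 0 ≤ S := Finset.sum_nonneg fun _ _ => sq_nonneg _
  have hΦ0 : 0 ≤ Φ := Finset.sum_nonneg fun _ _ => sq_nonneg _
  have h3 : S ≤ ∑ k ∈ Finset.range N, vnorm (f k) * vnorm (h (N - 1 - k)) :=
    h1.le.trans (Finset.sum_le_sum fun k _ => dotProduct_le _ _)
  have h4 : S ^ 2 ≤ Φ * (6 * (Γ / q) ^ 2 * S) := by
    refine (pow_le_pow_left₀ hS0 h3 2).trans ((Finset.sum_mul_sq_le_sq_mul_sq _ _ _).trans ?_)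
    rw [Finset.sum_range_reflect (fun k => vnorm (h k) ^ 2)]
    gcongr
  rcases hS0.eq_or_lt with h5 | h5
  · rw [← h5]; positivity
  · refine le_of_mul_le_mul_right ?_ h5
    linarith

/-- A small gain theorem: stability of `L` is inherited by `L + E`. -/
lemma sum_perturbed_pow_le {E : Matrix (Fin n) (Fin n) ℝ} {s T e : ℝ}
    (hL : ∀ k, ‖L ^ k‖ ≤ τ * γ ^ k) (hτ : 1 ≤ τ) (hγ : 0 ≤ γ) (hγ1 : γ < 1)
    (hT : T = τ ^ 2 / (1 - γ ^ 2))
    (hP : P.PosSemidef) (hPn : ‖P‖ ≤ Γ) (hq : 0 < q) (hqΓ : q ≤ Γ) (hqs : 1 ≤ s ^ 2 * q)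
    (hLP : ∀ v, quad P (L *ᵥ v) + q * vnorm v ^ 2 ≤ quad P v)
    (hE : ‖E‖ ≤ e) (hsmall : 20 * T * Γ * s ^ 2 * e ^ 2 ≤ 1) (v : Fin n → ℝ) (N : ℕ) :
    ∑ k ∈ Finset.range N, vnorm ((L + E)ᵀ ^ k *ᵥ v) ^ 2 ≤ 4 * T * vnorm v ^ 2 := by
  have hΓ : 0 < Γ := hq.trans_le hqΓ
  have hγ2 : 0 < 1 - γ ^ 2 := by nlinarith
  have hT0 : 0 < T := by rw [hT]; positivity
  set y : ℕ → Fin n → ℝ := fun k => (L + E)ᵀ ^ k *ᵥ v with hy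
  set f : ℕ → Fin n → ℝ := fun k => Eᵀ *ᵥ y k with hf
  set z : ℕ → Fin n → ℝ := fun k => y k - Lᵀ ^ k *ᵥ v with hz
  have hz0 : z 0 = 0 := by simp [hz, hy]
  have hzs : ∀ k, z (k + 1) = Lᵀ *ᵥ z k + f k := fun k => by
    simp only [hz, hf, hy, pow_succ', ← Matrix.mulVec_mulVec, Matrix.mulVec_sub,
      Matrix.transpose_add, Matrix.add_mulVec]
    abel
  set S := ∑ k ∈ Finset.range N, vnorm (z k) ^ 2 with hS
  set Φ := ∑ k ∈ Finset.range N, vnorm (f k) ^ 2 with hΦ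
  set Y := ∑ k ∈ Finset.range N, vnorm (y k) ^ 2 with hY
  have hS0 : 0 ≤ S := Finset.sum_nonneg fun _ _ => sq_nonneg _
  have hΦ0 : 0 ≤ Φ := Finset.sum_nonneg fun _ _ => sq_nonneg _
  have h1 : S ≤ (2 * T) ^ 2 * Φ := by
    refine (sum_response_le_of_norm_pow_le hL hγ hγ1 hz0 hzs N).trans ?_
    have h3 : τ / (1 - γ) ≤ 2 * T := by
      have h4 : τ / (1 - γ) = τ * (1 + γ) / (1 - γ ^ 2) := by
        rw [div_eq_div_iff (by linarith) hγ2.ne']; ring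
      rw [h4, hT, ← mul_div_assoc, div_le_div_iff_of_pos_right hγ2]
      nlinarith
    have h5 : 0 ≤ τ / (1 - γ) := div_nonneg (by linarith) (by linarith)
    gcongr
  have h2 : S ≤ 6 * (Γ * s ^ 2) ^ 2 * Φ := by
    refine (sum_dual_response_le_of_lyapunov hP hPn hq hqΓ hLP hz0 hzs N).trans ?_
    have : Γ / q ≤ Γ * s ^ 2 := by
      rw [div_le_iff₀ hq]; nlinarith
    gcongr
  -- Geometric mean of the two energy bounds, with 24 ≤ 5². The decay bound alone would put T² into
  -- the smallness condition.
  have h3 : S ≤ 5 * T * (Γ * s ^ 2) * Φ := by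
    refine le_of_sq_le_sq ?_ (by positivity)
    calc S ^ 2 = S * S := sq S
      _ ≤ ((2 * T) ^ 2 * Φ) * (6 * (Γ * s ^ 2) ^ 2 * Φ) := mul_le_mul h1 h2 hS0 (by positivity)
      _ = 24 * (T * (Γ * s ^ 2) * Φ) ^ 2 := by ring
      _ ≤ 25 * (T * (Γ * s ^ 2) * Φ) ^ 2 := by gcongr; norm_num
      _ = _ := by ring
  have h4 : Φ ≤ e ^ 2 * Y := by
    rw [hΦ, hY, Finset.mul_sum]
    refine Finset.sum_le_sum fun k _ => ?_
    rw [← mul_pow]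
    have := vnorm_mulVec_le_of_le (M := Eᵀ) (c := e) (by rwa [norm_transpose]) (y k)
    exact pow_le_pow_left₀ (vnorm_nonneg _) this 2
  have hY0 : 0 ≤ Y := Finset.sum_nonneg fun _ _ => sq_nonneg _
  have h5 : 2 * S ≤ 1 / 2 * Y := by
    have h6 : 5 * T * (Γ * s ^ 2) * Φ ≤ 5 * T * (Γ * s ^ 2) * (e ^ 2 * Y) := by gcongr
    have h7 := mul_le_mul_of_nonneg_right hsmall hY0
    linarith
  have h6 : ∑ k ∈ Finset.range N, vnorm (Lᵀ ^ k *ᵥ v) ^ 2 ≤ T * vnorm v ^ 2 := by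
    have h7 : ∀ k ∈ Finset.range N, vnorm (Lᵀ ^ k *ᵥ v) ^ 2 ≤
        τ ^ 2 * vnorm v ^ 2 * (γ ^ 2) ^ k := fun k _ => by
      refine (pow_le_pow_left₀ (vnorm_nonneg _)
        (vnorm_transpose_pow_mulVec_le (hL k) v) 2).trans (le_of_eq ?_)
      rw [mul_pow, mul_pow, ← pow_mul, ← pow_mul, mul_comm k 2]; ring
    refine (Finset.sum_le_sum h7).trans ?_
    rw [← Finset.mul_sum, hT]
    have h8 := (summable_geometric_of_lt_one (sq_nonneg γ) (by linarith)).sum_le_tsum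
      (Finset.range N) fun _ _ => by positivity
    rw [tsum_geometric_of_lt_one (sq_nonneg γ) (by linarith)] at h8
    calc _ ≤ τ ^ 2 * vnorm v ^ 2 * (1 - γ ^ 2)⁻¹ := by gcongr
      _ = _ := by ring
  have h7 : Y ≤ 2 * ∑ k ∈ Finset.range N, vnorm (Lᵀ ^ k *ᵥ v) ^ 2 + 2 * S := by
    rw [hY, hS, Finset.mul_sum, Finset.mul_sum, ← Finset.sum_add_distrib]
    refine Finset.sum_le_sum fun k _ => ?_
    have h8 : y k = Lᵀ ^ k *ᵥ v + z k := by simp [hz]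
    have h9 := vnorm_add_le (Lᵀ ^ k *ᵥ v) (z k)
    rw [← h8] at h9
    have := vnorm_nonneg (y k)
    nlinarith [sq_nonneg (vnorm (Lᵀ ^ k *ᵥ v) - vnorm (z k)),
      pow_le_pow_left₀ this h9 2]
  linarith

end SmallGain

/-! ### Second moments of the noise -/

section Noise

variable {n d : ℕ} {σ : ℝ}

/-- The variance of a coordinate of `ω t` under `noiseLaw`. -/
def noiseVar (σ : ℝ) (t : ℕ) : ℝ := if t = 0 then 1 else σ ^ 2

lemma noiseVar_nonneg (t : ℕ) : 0 ≤ noiseVar σ t := by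
  unfold noiseVar; split_ifs <;> positivity

lemma noiseLaw_eq : noiseLaw n σ = Measure.infinitePi fun t =>
    multivariateGaussian 0 (noiseVar σ t • (1 : Matrix (Fin n) (Fin n) ℝ)) := by
  unfold noiseLaw noiseVar
  congr! 2 with t
  split_ifs <;> simp

instance : IsProbabilityMeasure (noiseLaw n σ) := by
  rw [noiseLaw_eq]; infer_instance

lemma posSemidef_noise (t : ℕ) : (noiseVar σ t • (1 : Matrix (Fin n) (Fin n) ℝ)).PosSemidef :=
  Matrix.PosSemidef.one.smul (noiseVar_nonneg t)

lemma memLp_gaussian_coord {S : Matrix (Fin n) (Fin n) ℝ} (a : Fin n) :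
    MemLp (fun x : EuclideanSpace ℝ (Fin n) => x a) 2 (multivariateGaussian 0 S) :=
  IsGaussian.memLp_dual (multivariateGaussian 0 S) (EuclideanSpace.proj (𝕜 := ℝ) a) 2 (by simp)

lemma integral_gaussian_coord {S : Matrix (Fin n) (Fin n) ℝ} (a : Fin n) :
    ∫ x : EuclideanSpace ℝ (Fin n), x a ∂(multivariateGaussian 0 S) = 0 := by
  have := (EuclideanSpace.proj (𝕜 := ℝ) a).integral_comp_id_comm
    (IsGaussian.integrable_id (μ := multivariateGaussian 0 S))
  simpa using this

lemma measurePreserving_eval_noise (t : ℕ) :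
    MeasurePreserving (fun ω : ℕ → EuclideanSpace ℝ (Fin n) => ω t) (noiseLaw n σ)
      (multivariateGaussian 0 (noiseVar σ t • (1 : Matrix (Fin n) (Fin n) ℝ))) := by
  rw [noiseLaw_eq]
  exact measurePreserving_eval_infinitePi _ t

lemma integral_noise_comp (t : ℕ) {g : EuclideanSpace ℝ (Fin n) → ℝ} (hg : Measurable g) :
    ∫ ω, g (ω t) ∂(noiseLaw n σ) =
      ∫ x, g x ∂(multivariateGaussian 0 (noiseVar σ t • (1 : Matrix (Fin n) (Fin n) ℝ))) := by
  have h := measurePreserving_eval_noise (n := n) (σ := σ) t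
  rw [← h.map_eq, integral_map h.measurable.aemeasurable hg.aestronglyMeasurable]

lemma memLp_noise (t : ℕ) (a : Fin n) :
    MemLp (fun ω : ℕ → EuclideanSpace ℝ (Fin n) => ω t a) 2 (noiseLaw n σ) :=
  (memLp_gaussian_coord a).comp_measurePreserving (measurePreserving_eval_noise t)

lemma integrable_noise_mul (s t : ℕ) (a b : Fin n) :
    Integrable (fun ω : ℕ → EuclideanSpace ℝ (Fin n) => ω s a * ω t b) (noiseLaw n σ) :=
  (memLp_noise s a).integrable_mul (memLp_noise t b)

lemma integral_noise_mul (s t : ℕ) (a b : Fin n) :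
    ∫ ω, ω s a * ω t b ∂(noiseLaw n σ) = if s = t ∧ a = b then noiseVar σ t else 0 := by
  by_cases hst : s = t
  · subst hst
    rw [integral_noise_comp (n := n) (σ := σ) s (g := fun x => x a * x b) (by fun_prop)]
    have h2 := covariance_eval_multivariateGaussian (μ := 0)
      (posSemidef_noise (n := n) (σ := σ) s) a b
    rw [covariance_eq_sub (memLp_gaussian_coord a) (memLp_gaussian_coord b),
      integral_gaussian_coord, integral_gaussian_coord, mul_zero, sub_zero] at h2
    refine h2.trans ?_
    simp [Matrix.one_apply]
  · have hind : iIndepFun (fun i (ω : ℕ → EuclideanSpace ℝ (Fin n)) => ω i) (noiseLaw n σ) := by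
      rw [noiseLaw_eq]
      exact iIndepFun_infinitePi (X := fun _ ω => ω) fun i => measurable_id
    have h1 := (hind.indepFun hst).comp (φ := fun x : EuclideanSpace ℝ (Fin n) => x a)
      (ψ := fun x : EuclideanSpace ℝ (Fin n) => x b) (by fun_prop) (by fun_prop)
    have h2 := h1.integral_mul_eq_mul_integral (memLp_noise s a).aestronglyMeasurable
      (memLp_noise t b).aestronglyMeasurable
    have h3 : ∫ ω, ω s a ∂(noiseLaw n σ) = 0 := by
      rw [integral_noise_comp (n := n) (σ := σ) s (g := fun x => x a) (by fun_prop),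
        integral_gaussian_coord]
    simp only [hst, false_and, if_false]
    refine h2.trans ?_
    simp only [Function.comp_def, h3, zero_mul]

lemma dotProduct_mulVec_eq_sum (N : Matrix (Fin n) (Fin n) ℝ) (x y : Fin n → ℝ) :
    x ⬝ᵥ (N *ᵥ y) = ∑ a, ∑ b, N a b * (x a * y b) := by
  simp only [dotProduct, Matrix.mulVec, Finset.mul_sum]
  exact Finset.sum_congr rfl fun a _ => Finset.sum_congr rfl fun b _ => by ring

lemma integrable_noise_bilin (N : Matrix (Fin n) (Fin n) ℝ) (s t : ℕ) :
    Integrable (fun ω : ℕ → EuclideanSpace ℝ (Fin n) => (ω s).ofLp ⬝ᵥ (N *ᵥ (ω t).ofLp))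
      (noiseLaw n σ) := by
  simp only [dotProduct_mulVec_eq_sum]
  exact integrable_finsetSum _ fun a _ => integrable_finsetSum _ fun b _ =>
    (integrable_noise_mul s t a b).const_mul _

lemma integral_noise_double_sum (W : Fin n → Fin n → ℝ) (s t : ℕ) :
    ∫ ω, ∑ a, ∑ b, W a b * (ω s a * ω t b) ∂(noiseLaw n σ) =
      if s = t then noiseVar σ t * ∑ a, W a a else 0 := by
  rw [integral_finsetSum _ fun a _ => integrable_finsetSum _ fun b _ =>
    (integrable_noise_mul s t a b).const_mul _]
  simp only [integral_finsetSum _ fun b _ => (integrable_noise_mul s t _ b).const_mul _,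
    integral_const_mul, integral_noise_mul]
  by_cases hst : s = t
  · simp [hst, Finset.mul_sum, mul_comm]
  · simp [hst]

lemma integral_noise_bilin (N : Matrix (Fin n) (Fin n) ℝ) (s t : ℕ) :
    ∫ ω, (ω s).ofLp ⬝ᵥ (N *ᵥ (ω t).ofLp) ∂(noiseLaw n σ) =
      if s = t then noiseVar σ t * N.trace else 0 := by
  simp only [dotProduct_mulVec_eq_sum]
  exact integral_noise_double_sum N s t

end Noise

/-! ### The average cost as a series of traces -/

section AverageCost

variable {n d : ℕ} {A : Matrix (Fin n) (Fin n) ℝ} {B : Matrix (Fin n) (Fin d) ℝ}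
  {Q : Matrix (Fin n) (Fin n) ℝ} {R : Matrix (Fin d) (Fin d) ℝ} {K : Matrix (Fin d) (Fin n) ℝ}
  {σ : ℝ}

lemma state_eq_sum (ω : ℕ → EuclideanSpace ℝ (Fin n)) (t : ℕ) :
    state A B K ω t = ∑ j ∈ Finset.range (t + 1), (A + B * K) ^ (t - j) *ᵥ (ω j).ofLp := by
  induction t with
  | zero => simp [state]
  | succ t ih =>
    rw [Finset.sum_range_succ, state, Matrix.mulVec_mulVec, ← Matrix.add_mulVec, ih,
      Matrix.mulVec_sum]
    congr 1
    · refine Finset.sum_congr rfl fun j hj => ?_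
      have := Finset.mem_range.1 hj
      rw [Matrix.mulVec_mulVec, ← pow_succ', show t - j + 1 = t + 1 - j by omega]
    · simp

lemma stageCost_mulVec (x : Fin n → ℝ) :
    stageCost Q R x (K *ᵥ x) = quad (Q + Kᵀ * R * K) x := by
  rw [quad_add_left, quad_conj, stageCost_eq]

lemma quad_sum_eq (W : Matrix (Fin n) (Fin n) ℝ) (s : Finset ℕ)
    (M : ℕ → Matrix (Fin n) (Fin n) ℝ) (y : ℕ → Fin n → ℝ) :
    quad W (∑ j ∈ s, M j *ᵥ y j) =
      ∑ i ∈ s, ∑ j ∈ s, y i ⬝ᵥ (((M i)ᵀ * W * M j) *ᵥ y j) := by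
  rw [quad, Matrix.mulVec_sum, sum_dotProduct]
  refine Finset.sum_congr rfl fun i _ => ?_
  rw [dotProduct_sum]
  refine Finset.sum_congr rfl fun j _ => ?_
  rw [← dotProduct_transpose_mulVec]
  simp only [Matrix.mulVec_mulVec, Matrix.mul_assoc]

lemma integrable_stageCost (t : ℕ) : Integrable (fun ω =>
    stageCost Q R (state A B K ω t) (K *ᵥ state A B K ω t)) (noiseLaw n σ) := by
  simp only [stageCost_mulVec, state_eq_sum, quad_sum_eq]
  exact integrable_finsetSum _ fun i _ => integrable_finsetSum _ fun j _ =>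
    integrable_noise_bilin _ i j

/-- The contribution to the cost of noise injected `k` steps ago. -/
noncomputable def costTerm (Q : Matrix (Fin n) (Fin n) ℝ) (R : Matrix (Fin d) (Fin d) ℝ)
    (K : Matrix (Fin d) (Fin n) ℝ) (L : Matrix (Fin n) (Fin n) ℝ) (k : ℕ) : ℝ :=
  ((L ^ k)ᵀ * (Q + Kᵀ * R * K) * L ^ k).trace

/-- Independence leaves the diagonal terms only; x₀ has unit covariance, hence the separate term
without σ². -/
lemma integral_stageCost (t : ℕ) :
    ∫ ω, stageCost Q R (state A B K ω t) (K *ᵥ state A B K ω t) ∂(noiseLaw n σ) =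
      costTerm Q R K (A + B * K) t +
        σ ^ 2 * ∑ k ∈ Finset.range t, costTerm Q R K (A + B * K) k := by
  simp only [stageCost_mulVec, state_eq_sum, quad_sum_eq]
  rw [integral_finsetSum _ fun i _ => integrable_finsetSum _ fun j _ =>
    integrable_noise_bilin _ i j]
  simp only [integral_finsetSum _ fun j _ => integrable_noise_bilin _ _ j, integral_noise_bilin]
  have h1 : ∀ i ∈ Finset.range (t + 1), (∑ j ∈ Finset.range (t + 1),
      if i = j then noiseVar σ j * (((A + B * K) ^ (t - i))ᵀ * (Q + Kᵀ * R * K) *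
        (A + B * K) ^ (t - j)).trace else 0) =
      noiseVar σ i * costTerm Q R K (A + B * K) (t - i) := fun i hi => by
    rw [Finset.sum_ite_eq, if_pos hi]; rfl
  rw [Finset.sum_congr rfl h1, Finset.sum_range_succ']
  simp only [noiseVar, Nat.add_eq_zero_iff, one_ne_zero, and_false, if_false, if_true, one_mul,
    Nat.sub_zero, ← Finset.mul_sum]
  rw [add_comm, ← Finset.sum_range_reflect (fun k => costTerm Q R K (A + B * K) k)]
  simp only [Nat.sub_sub, add_comm 1]

/-- The contribution of x₀ tends to zero, so the expected stage costs converge, and so do their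
Cesàro means. -/
lemma isCost_of_hasSum {v : ℝ} (h : HasSum (costTerm Q R K (A + B * K)) v) :
    IsCost A B Q R σ K (σ ^ 2 * v) := by
  set m := costTerm Q R K (A + B * K)
  set e : ℕ → ℝ := fun t => m t + σ ^ 2 * ∑ k ∈ Finset.range t, m k with he
  have h1 : Tendsto e atTop (𝓝 (σ ^ 2 * v)) := by
    have := h.summable.tendsto_atTop_zero.add (h.tendsto_sum_nat.const_mul (σ ^ 2))
    rwa [zero_add] at this
  have h2 := (tendsto_add_atTop_iff_nat 1).2 h1.cesaro
  -- The average has T + 1 terms but is divided by T.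
  have h3 : Tendsto (fun T : ℕ => ((T : ℝ) + 1) / T) atTop (𝓝 1) := by
    have h4 : Tendsto (fun T : ℕ => 1 + (1 : ℝ) / T) atTop (𝓝 (1 + 0)) :=
      tendsto_one_div_atTop_nhds_zero_nat.const_add 1
    rw [add_zero] at h4
    refine h4.congr' ?_
    filter_upwards [eventually_gt_atTop 0] with T hT
    have : (T : ℝ) ≠ 0 := by positivity
    field_simp
  have h5 := h3.mul h2
  rw [one_mul] at h5
  refine h5.congr fun T => ?_
  have h6 : avgCost A B Q R σ K T = (1 / (T : ℝ)) * ∑ t ∈ Finset.range (T + 1), e t := by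
    rw [avgCost, integral_const_mul, integral_finsetSum _ fun t _ => integrable_stageCost t]
    simp only [integral_stageCost, he]
    rfl
  rw [h6]
  push_cast
  field_simp

end AverageCost

/-! ### The sub-optimality gap -/

section Gap

variable {n d ℓ : ℕ} {A A' : Matrix (Fin n) (Fin n) ℝ} {B B' : Matrix (Fin n) (Fin d) ℝ}
  {Q P : Matrix (Fin n) (Fin n) ℝ} {R : Matrix (Fin d) (Fin d) ℝ} {K' : Matrix (Fin d) (Fin n) ℝ}
  {ν α Γ q c s ε σ T τ γ : ℝ}

lemma quad_single (M : Matrix (Fin n) (Fin n) ℝ) (i : Fin n) : quad M (Pi.single i 1) = M i i := by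
  simp [quad]

lemma trace_conj_eq_sum {m : ℕ} (M : Matrix (Fin m) (Fin m) ℝ) (F : Matrix (Fin m) (Fin n) ℝ) :
    (Fᵀ * M * F).trace = ∑ i, quad M (F *ᵥ Pi.single i 1) := by
  exact Finset.sum_congr rfl fun i _ => by rw [← quad_conj, quad_single, Matrix.diag_apply]

/-- The Frobenius norm is invariant under transposition. This trades a sum over n states for one
over d inputs. -/
lemma sum_vnorm_mulVec_single_sq {m : ℕ} (F : Matrix (Fin m) (Fin n) ℝ) :
    ∑ i, vnorm (F *ᵥ Pi.single i 1) ^ 2 = ∑ a, vnorm (Fᵀ *ᵥ Pi.single a 1) ^ 2 := by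
  simp only [vnorm_sq, Matrix.mulVec_single_one, dotProduct]
  exact Finset.sum_comm

lemma vnorm_single {m : ℕ} (a : Fin m) : vnorm (Pi.single a 1 : Fin m → ℝ) = 1 := by
  have h : vnorm (Pi.single a 1 : Fin m → ℝ) ^ 2 = 1 := by rw [vnorm_sq]; simp
  exact (pow_eq_one_iff_of_nonneg (vnorm_nonneg _) two_ne_zero).1 h

/-- If M ≥ I then M ≤ M²; the excess cost is thus bounded through M(K' - K). -/
lemma quad_le_vnorm_mulVec_sq {m : ℕ} {M : Matrix (Fin m) (Fin m) ℝ}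
    (h : ∀ u, vnorm u ^ 2 ≤ quad M u) (u : Fin m → ℝ) : quad M u ≤ vnorm (M *ᵥ u) ^ 2 := by
  have h1 := h u
  have h2 : quad M u ≤ vnorm u * vnorm (M *ᵥ u) := dotProduct_le _ _
  have h3 := vnorm_nonneg u
  have h4 := vnorm_nonneg (M *ᵥ u)
  have h5 : vnorm u ≤ vnorm (M *ᵥ u) := by
    rcases h3.eq_or_lt with h0 | h0
    · rwa [← h0]
    · exact le_of_mul_le_mul_left (by nlinarith) h0
  nlinarith

lemma costTerm_nonneg (hQ : Q.PosSemidef) (hR : R.PosSemidef) (L : Matrix (Fin n) (Fin n) ℝ)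
    (k : ℕ) : 0 ≤ costTerm Q R K' L k := by
  rw [costTerm, trace_conj_eq_sum]
  refine Finset.sum_nonneg fun i _ => ?_
  rw [← stageCost_mulVec]
  exact stageCost_nonneg hQ hR _ _

/-- Cost difference formula. -/
lemma IsDareSolution.sum_costTerm (h : IsDareSolution A B Q R P) (hR : R.PosDef) (N : ℕ) :
    ∑ k ∈ Finset.range N, costTerm Q R K' (A + B * K') k +
        ∑ i, quad P ((A + B * K') ^ N *ᵥ Pi.single i 1) =
      P.trace + ∑ k ∈ Finset.range N, ∑ i, quad (R + Bᵀ * P * B)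
        ((K' - greedyGain A B R P) *ᵥ ((A + B * K') ^ k *ᵥ Pi.single i 1)) := by
  induction N with
  | zero =>
    simp only [Finset.range_zero, Finset.sum_empty, pow_zero, Matrix.one_mulVec, quad_single,
      zero_add, add_zero]
    rfl
  | succ N ih =>
    rw [Finset.sum_range_succ, Finset.sum_range_succ, ← add_assoc, ← ih, costTerm,
      trace_conj_eq_sum]
    have h1 : ∀ i : Fin n, quad (Q + K'ᵀ * R * K') ((A + B * K') ^ N *ᵥ Pi.single i 1) +
        quad P ((A + B * K') ^ (N + 1) *ᵥ Pi.single i 1) =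
        quad P ((A + B * K') ^ N *ᵥ Pi.single i 1) + quad (R + Bᵀ * P * B)
        ((K' - greedyGain A B R P) *ᵥ ((A + B * K') ^ N *ᵥ Pi.single i 1)) := fun i => by
      rw [pow_succ', ← Matrix.mulVec_mulVec]
      set y := (A + B * K') ^ N *ᵥ (Pi.single i 1 : Fin n → ℝ)
      have h2 := quad_riccatiMap_add (A := A) (B := B) (Q := Q) hR h.posSemidef y (K' *ᵥ y)
      rw [h.riccatiMap_eq, ← Matrix.sub_mulVec, stageCost_mulVec, Matrix.mulVec_mulVec y B,
        ← Matrix.add_mulVec] at h2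
      exact h2.symm
    have h3 := Finset.sum_congr (rfl : (Finset.univ : Finset (Fin n)) = _) fun i _ => h1 i
    rw [Finset.sum_add_distrib, Finset.sum_add_distrib] at h3
    linarith

/-- For the optimal gain the excess in the cost difference formula is zero, and the terminal term
vanishes since the optimal trajectories tend to zero. -/
lemma IsDareSolution.hasSum_costTerm (h : IsDareSolution A B Q R P) (hQ : Q.PosDef)
    (hR : R.PosDef) :
    HasSum (costTerm Q R (greedyGain A B R P) (A + B * greedyGain A B R P)) P.trace := by
  rw [hasSum_iff_tendsto_nat_of_nonneg fun k => costTerm_nonneg hQ.posSemidef hR.posSemidef _ k]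
  set L := A + B * greedyGain A B R P with hL
  have h0 : ∀ v, Tendsto (fun N => quad P (L ^ N *ᵥ v)) atTop (𝓝 0) := fun v => by
    have h1 := tendsto_zero_of_sum_stageCost_le (x := fun k => L ^ k *ᵥ v) hQ hR
      (h.sum_greedy_le hR fun k => by
        simp only [pow_succ', ← Matrix.mulVec_mulVec]
        conv_lhs => rw [hL, Matrix.add_mulVec, ← Matrix.mulVec_mulVec])
    have h2 := h1.const_mul ‖P‖
    rw [mul_zero] at h2
    exact squeeze_zero (fun N => quad_nonneg h.posSemidef _) (fun N => quad_le_norm P _) h2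
  have h1 : Tendsto (fun N => P.trace - ∑ i, quad P (L ^ N *ᵥ Pi.single i 1)) atTop
      (𝓝 (P.trace - ∑ _i : Fin n, 0)) :=
    (tendsto_finsetSum _ fun i _ => h0 _).const_sub _
  rw [Finset.sum_const_zero, sub_zero] at h1
  refine h1.congr fun N => ?_
  have h2 := h.sum_costTerm (K' := greedyGain A B R P) hR N
  simp only [sub_self, Matrix.zero_mulVec, quad_zero_right, Finset.sum_const_zero, add_zero] at h2
  linarith

/-- After transposition the excess is the energy of the transposed loop started at the d rows of W,
each of norm at most m. -/
lemma IsDareSolution.exists_hasSum_costTerm (h : IsDareSolution A B Q R P)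
    (hQR : CostBounds Q R q c s) {m : ℝ} (hT : 0 ≤ T)
    (hW : ‖(R + Bᵀ * P * B) * (K' - greedyGain A B R P)‖ ≤ m)
    (hstab : ∀ v N, ∑ k ∈ Finset.range N, vnorm ((A + B * K')ᵀ ^ k *ᵥ v) ^ 2 ≤
      4 * T * vnorm v ^ 2) :
    ∃ v, HasSum (costTerm Q R K' (A + B * K')) v ∧ v ≤ P.trace + 4 * T * d * m ^ 2 := by
  set M := R + Bᵀ * P * B with hM
  set W := M * (K' - greedyGain A B R P) with hWdef
  set L := A + B * K' with hL
  have hM1 : ∀ u, vnorm u ^ 2 ≤ quad M u := fun u => by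
    rw [hM, quad_add_left, quad_conj]
    linarith [hQR.vnorm_sq_le u, quad_nonneg h.posSemidef (B *ᵥ u)]
  have hrow : ∀ a, vnorm (Wᵀ *ᵥ Pi.single a 1) ≤ m := fun a => by
    have := vnorm_mulVec_le_of_le (M := Wᵀ) (c := m) (by rwa [norm_transpose]) (Pi.single a 1)
    rwa [vnorm_single, mul_one] at this
  have hexc : ∀ N, ∑ k ∈ Finset.range N, ∑ i, quad M
      ((K' - greedyGain A B R P) *ᵥ (L ^ k *ᵥ Pi.single i 1)) ≤ 4 * T * d * m ^ 2 := fun N => by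
    have h1 : ∀ k ∈ Finset.range N, ∑ i, quad M
        ((K' - greedyGain A B R P) *ᵥ (L ^ k *ᵥ Pi.single i 1)) ≤
        ∑ a, vnorm (Lᵀ ^ k *ᵥ (Wᵀ *ᵥ Pi.single a 1)) ^ 2 := fun k _ => by
      have h2 := sum_vnorm_mulVec_single_sq (W * L ^ k)
      simp only [Matrix.transpose_mul, Matrix.transpose_pow, ← Matrix.mulVec_mulVec] at h2
      rw [← h2]
      refine Finset.sum_le_sum fun i _ => (quad_le_vnorm_mulVec_sq hM1 _).trans ?_
      rw [hWdef, ← Matrix.mulVec_mulVec _ M]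
    refine (Finset.sum_le_sum h1).trans ?_
    rw [Finset.sum_comm]
    refine (Finset.sum_le_sum (g := fun _ => 4 * T * m ^ 2) fun a _ => (hstab _ N).trans ?_).trans ?_
    · have := vnorm_nonneg (Wᵀ *ᵥ (Pi.single a 1 : Fin d → ℝ))
      gcongr
      exact hrow a
    · simp; linarith
  have hpart : ∀ N, ∑ k ∈ Finset.range N, costTerm Q R K' L k ≤ P.trace + 4 * T * d * m ^ 2 :=
    fun N => by
    have h1 := h.sum_costTerm (K' := K') hQR.posDef_R N
    have h2 : 0 ≤ ∑ i, quad P (L ^ N *ᵥ Pi.single i 1) :=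
      Finset.sum_nonneg fun i _ => quad_nonneg h.posSemidef _
    linarith [hexc N]
  have hnn : ∀ k, 0 ≤ costTerm Q R K' L k := fun k =>
    costTerm_nonneg hQR.posDef_Q.posSemidef hQR.posDef_R.posSemidef _ k
  exact ⟨_, (summable_of_sum_range_le hnn hpart).hasSum,
    Real.tsum_le_of_sum_range_le hnn hpart⟩

/-- Sub-optimality gap of the certainty equivalent controller, with explicit constants. -/
theorem IsDareSolution.gap_le (hc : ControlBounds A B ℓ ν α Γ) (hQR : CostBounds Q R q c s)
    (h : IsDareSolution A B Q R P) (hPn : ‖P‖ ≤ Γ) (hKn : 1 + ‖greedyGain A B R P‖ ≤ Γ)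
    (hqΓ : q ≤ Γ) (hL : ∀ k, ‖(A + B * greedyGain A B R P) ^ k‖ ≤ τ * γ ^ k) (hτ : 1 ≤ τ)
    (hγ : 0 ≤ γ) (hγ1 : γ < 1) (hT : T = τ ^ 2 / (1 - γ ^ 2))
    (hε : 0 ≤ ε) (hA : ‖A' - A‖ ≤ ε) (hB : ‖B' - B‖ ≤ ε)
    (hsmall : 3000000 * (Γ ^ 15 * s ^ 4 * ((1 + 1 / ν) * ℓ ^ 2 * α ^ 2) ^ 2 * T * ε ^ 2) ≤ 1) :
    (∃! P', IsDareSolution A' B' Q R P') ∧ ∀ P', IsDareSolution A' B' Q R P' →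
      ∃ Jhat Jstar : ℝ, IsCost A B Q R σ (greedyGain A' B' R P') Jhat ∧
        IsCost A B Q R σ (greedyGain A B R P) Jstar ∧
        Jhat - Jstar ≤ 3000000 * σ ^ 2 * d *
          (Γ ^ 15 * s ^ 4 * ((1 + 1 / ν) * ℓ ^ 2 * α ^ 2) ^ 2 * T * ε ^ 2) := by
  have hΓ := hc.one_le_Γ
  have hs := hQR.one_le_s
  have hν := hc.ν_pos
  set X := (1 + 1 / ν) * (ℓ : ℝ) ^ 2 * α ^ 2 with hX
  have hX0 : 1 ≤ X := by
    have h1 : (1 : ℝ) ≤ 1 + 1 / ν := by have := one_div_pos.2 hν; linarith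
    have h2 : (1 : ℝ) ≤ (ℓ : ℝ) ^ 2 := one_le_pow₀ (by exact_mod_cast hc.one_le_ℓ)
    have h3 : (1 : ℝ) ≤ α ^ 2 := one_le_pow₀ hc.one_le_α
    exact one_le_mul_of_one_le_of_one_le (one_le_mul_of_one_le_of_one_le h1 h2) h3
  have hT1 : 1 ≤ T := by
    have h1 : 0 < 1 - γ ^ 2 := by nlinarith
    rw [hT, le_div_iff₀ h1]; nlinarith
  -- E dominates the squares of all smallness conditions; its exponents are those of the small gain
  -- condition below.
  set E := Γ ^ 15 * s ^ 4 * X ^ 2 * T * ε ^ 2 with hE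
  have hE0 : 0 ≤ E := by positivity
  have hE1 : Γ ^ 8 * s ^ 4 * ε ^ 2 ≤ E := by
    have h1 : Γ ^ 8 ≤ Γ ^ 15 := pow_le_pow_right₀ hΓ (by norm_num)
    have h2 : 1 ≤ X ^ 2 * T := one_le_mul_of_one_le_of_one_le (one_le_pow₀ hX0) hT1
    calc Γ ^ 8 * s ^ 4 * ε ^ 2 ≤ Γ ^ 15 * s ^ 4 * ε ^ 2 * (X ^ 2 * T) := by
          refine le_trans ?_ (le_mul_of_one_le_right (by positivity) h2)
          gcongr
      _ = E := by rw [hE]; ring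
  have hE2 : Γ ^ 4 * s ^ 2 * X ^ 2 * ε ^ 2 ≤ E := by
    have h1 : Γ ^ 4 ≤ Γ ^ 15 := pow_le_pow_right₀ hΓ (by norm_num)
    have h2 : s ^ 2 ≤ s ^ 4 := pow_le_pow_right₀ hs (by norm_num)
    calc Γ ^ 4 * s ^ 2 * X ^ 2 * ε ^ 2 ≤ Γ ^ 15 * s ^ 4 * X ^ 2 * ε ^ 2 * T := by
          refine le_trans ?_ (le_mul_of_one_le_right (by positivity) hT1)
          gcongr
      _ = E := by rw [hE]; ring
  have hE3 : Γ ^ 12 * s ^ 2 * X ^ 2 * T * ε ^ 2 ≤ E := by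
    have h1 : Γ ^ 12 ≤ Γ ^ 15 := pow_le_pow_right₀ hΓ (by norm_num)
    have h2 : s ^ 2 ≤ s ^ 4 := pow_le_pow_right₀ hs (by norm_num)
    rw [hE]; gcongr
  have hsm1 : 216 * Γ ^ 4 * s ^ 2 * ε ≤ 1 := by
    refine le_of_sq_le_sq ?_ zero_le_one
    calc (216 * Γ ^ 4 * s ^ 2 * ε) ^ 2 = 46656 * (Γ ^ 8 * s ^ 4 * ε ^ 2) := by ring
      _ ≤ 1 ^ 2 := by linarith
  have hsm2 : 30 * Γ ^ 2 * X * s * ε ≤ 1 := by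
    refine le_of_sq_le_sq ?_ zero_le_one
    calc (30 * Γ ^ 2 * X * s * ε) ^ 2 = 900 * (Γ ^ 4 * s ^ 2 * X ^ 2 * ε ^ 2) := by ring
      _ ≤ 1 ^ 2 := by linarith
  obtain ⟨hex, hpert⟩ := h.perturbation hc hQR hPn hKn hε hA hB hsm1 hsm2
  refine ⟨hex, fun P' h' => ?_⟩
  have hW := hpert P' h'
  rw [← hX] at hW
  set K := greedyGain A B R P with hK
  set K' := greedyGain A' B' R P' with hK'
  set m := 375 * Γ ^ 6 * X * s * ε with hm
  have hM1 : ∀ u, vnorm u ^ 2 ≤ quad (R + Bᵀ * P * B) u := fun u => by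
    rw [quad_add_left, quad_conj]
    linarith [hQR.vnorm_sq_le u, quad_nonneg h.posSemidef (B *ᵥ u)]
  have hm0 : 0 ≤ m := (norm_nonneg _).trans hW
  have hΔ : ‖K' - K‖ ≤ m := norm_le_of_vnorm_le hm0 fun v => by
    have h1 := (hM1 _).trans (quad_le_vnorm_mulVec_sq hM1 ((K' - K) *ᵥ v))
    rw [Matrix.mulVec_mulVec] at h1
    exact (le_of_sq_le_sq h1 (vnorm_nonneg _)).trans (vnorm_mulVec_le_of_le hW v)
  have hBΔ : ‖B * (K' - K)‖ ≤ Γ * m := (Matrix.l2_opNorm_mul _ _).trans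
    (mul_le_mul hc.norm_B_le hΔ (norm_nonneg _) (by linarith))
  have hstab : ∀ v N, ∑ k ∈ Finset.range N, vnorm ((A + B * K')ᵀ ^ k *ᵥ v) ^ 2 ≤
      4 * T * vnorm v ^ 2 := fun v N => by
    have h1 := sum_perturbed_pow_le (E := B * (K' - K)) (s := s) hL hτ hγ hγ1 hT h.posSemidef hPn
      hQR.q_pos hqΓ (hQR.one_le_c.trans hQR.le_s_sq) (fun v => ?_) hBΔ ?_ v N
    · rwa [show A + B * K + B * (K' - K) = A + B * K' by rw [Matrix.mul_sub]; abel] at h1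
    · have h2 := quad_closedLoop_add h.eq_closedLoop (R_mul_greedyGain hQR.posDef_R h.posSemidef) v
      rw [stageCost_eq, ← hK] at h2
      linarith [hQR.le_quad v, quad_nonneg hQR.posDef_R.posSemidef (K *ᵥ v)]
    -- The most demanding condition, with 20 · 375² = 2812500; it dictates the constant 3000000.
    · calc 20 * T * Γ * s ^ 2 * (Γ * m) ^ 2 = 2812500 * E := by rw [hm, hE]; ring
        _ ≤ 1 := by linarith
  obtain ⟨v, hv, hvle⟩ := h.exists_hasSum_costTerm hQR (by linarith) hW hstab
  refine ⟨_, _, isCost_of_hasSum hv,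
    isCost_of_hasSum (h.hasSum_costTerm hQR.posDef_Q hQR.posDef_R), ?_⟩
  have h1 : 4 * T * d * m ^ 2 ≤ 3000000 * d * E :=
    calc 4 * T * d * m ^ 2 = 562500 * d * (Γ ^ 12 * s ^ 2 * X ^ 2 * T * ε ^ 2) := by rw [hm]; ring
      _ ≤ 3000000 * d * E := by gcongr; norm_num
  calc σ ^ 2 * v - σ ^ 2 * P.trace = σ ^ 2 * (v - P.trace) := by ring
    _ ≤ σ ^ 2 * (3000000 * d * E) := by gcongr; linarith
    _ = _ := by ring

end Gap

/-! ### The transient constant as a real number -/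

section Transient

variable {n : ℕ} {M : Matrix (Fin n) (Fin n) ℝ} {ρ : ℝ}

lemma one_le_transient [Nonempty (Fin n)] : 1 ≤ transient M ρ := by
  refine le_trans ?_ (le_iSup (fun k : ℕ => ENNReal.ofReal ‖M ^ k‖ / ENNReal.ofReal ρ ^ k) 0)
  simp

lemma one_le_transient_toReal [Nonempty (Fin n)] (h : transient M ρ ≠ ∞) :
    1 ≤ (transient M ρ).toReal := by
  simpa using ENNReal.toReal_mono h one_le_transient

lemma norm_pow_le_transient [Nonempty (Fin n)] (h : transient M ρ ≠ ∞) (hρ : 0 ≤ ρ) (k : ℕ) :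
    ‖M ^ k‖ ≤ (transient M ρ).toReal * ρ ^ k := by
  have h1 : ENNReal.ofReal ‖M ^ k‖ / ENNReal.ofReal ρ ^ k ≤ transient M ρ :=
    le_iSup (fun k : ℕ => ENNReal.ofReal ‖M ^ k‖ / ENNReal.ofReal ρ ^ k) k
  -- For ρ = 0 the denominator vanishes at k > 0; finiteness of the supremum still allows it to be
  -- cleared.
  rw [ENNReal.div_le_iff_le_mul (Or.inr h)
    (Or.inl (ENNReal.pow_ne_top ENNReal.ofReal_ne_top)), ← ENNReal.ofReal_toReal h,
    ← ENNReal.ofReal_pow hρ, ← ENNReal.ofReal_mul ENNReal.toReal_nonneg] at h1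
  exact (ENNReal.ofReal_le_ofReal_iff (by positivity)).1 h1

lemma specRadius_nonneg : 0 ≤ specRadius M := ENNReal.toReal_nonneg

end Transient

/-! ### Condition number of the cost -/

section Constants

variable {n d : ℕ} {Q : Matrix (Fin n) (Fin n) ℝ} {R : Matrix (Fin d) (Fin d) ℝ}

/-- An infimum over the empty type is 0 in ℝ, so the lower bound on R already forces d ≥ 1. -/
lemma nonempty_of_one_le_sigmaMin (h : 1 ≤ sigmaMin R) : Nonempty (Fin d) := by
  by_contra hd
  rw [not_nonempty_iff] at hd
  have : sigmaMin R = 0 := by simp [sigmaMin]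
  linarith

lemma vnorm_sq_le_quad (hR : R.PosDef) (h : 1 ≤ sigmaMin R) (u : Fin d → ℝ) :
    vnorm u ^ 2 ≤ quad R u :=
  (le_mul_of_one_le_left (sq_nonneg _) h).trans (sigmaMin_mul_vnorm_sq_le_quad hR u)

lemma sigmaMin_le_norm [Nonempty (Fin n)] (hQ : Q.PosDef) : sigmaMin Q ≤ ‖Q‖ := by
  obtain ⟨i⟩ := (inferInstance : Nonempty (Fin n))
  have h1 := sigmaMin_mul_vnorm_sq_le_quad hQ (Pi.single i 1)
  have h2 := quad_le_norm Q (Pi.single i 1)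
  simp only [vnorm_single, one_pow, mul_one] at h1 h2
  exact h1.trans h2

/-- The condition number of the cost. -/
noncomputable def costCond (Q : Matrix (Fin n) (Fin n) ℝ) (R : Matrix (Fin d) (Fin d) ℝ) : ℝ :=
  max ‖Q‖ ‖R‖ / min (sigmaMin Q) (sigmaMin R)

lemma costCond_sq : costCond Q R ^ 2 = costCondSq Q R := by
  have h1 : max (‖Q‖ ^ 2) (‖R‖ ^ 2) = max ‖Q‖ ‖R‖ ^ 2 :=
    ((pow_left_monotoneOn (M₀ := ℝ) (n := 2)).map_max (norm_nonneg Q) (norm_nonneg R)).symm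
  have h2 : min (sigmaMin Q ^ 2) (sigmaMin R ^ 2) = min (sigmaMin Q) (sigmaMin R) ^ 2 :=
    ((pow_left_monotoneOn (M₀ := ℝ) (n := 2)).map_min (sigmaMin_nonneg Q) (sigmaMin_nonneg R)).symm
  rw [costCond, costCondSq, div_pow, h1, h2]

lemma costBounds_of_posDef [Nonempty (Fin n)] (hQ : Q.PosDef) (hR : R.PosDef)
    (h : 1 ≤ sigmaMin R) :
    CostBounds Q R (sigmaMin Q) (max ‖Q‖ ‖R‖) √(costCond Q R) := by
  have := nonempty_of_one_le_sigmaMin h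
  have hRn := sigmaMin_le_norm hR
  have hq := sigmaMin_pos hQ
  have hmin : 0 < min (sigmaMin Q) (sigmaMin R) := lt_min hq (by linarith)
  have hmax : sigmaMin R ≤ max ‖Q‖ ‖R‖ := hRn.trans (le_max_right _ _)
  have hκ : 1 ≤ costCond Q R := by
    rw [costCond, one_le_div hmin]
    exact (min_le_right _ _).trans hmax
  exact
    { posDef_Q := hQ
      posDef_R := hR
      q_pos := hq
      le_quad := sigmaMin_mul_vnorm_sq_le_quad hQ
      one_le_c := h.trans hmax
      norm_Q_le := le_max_left _ _
      norm_R_le := le_max_right _ _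
      one_le_s := Real.one_le_sqrt.2 hκ
      le_s_sq := by
        rw [Real.sq_sqrt (by linarith), costCond, div_mul_eq_mul_div, le_div_iff₀ hmin]
        exact mul_le_mul_of_nonneg_left (min_le_left _ _) (by linarith)
      vnorm_sq_le := vnorm_sq_le_quad hR h }

end Constants

/-! ### From the extended-real bound to real constants -/

section Unpacking

variable {n d ℓ : ℕ} {A : Matrix (Fin n) (Fin n) ℝ} {B : Matrix (Fin n) (Fin d) ℝ}
  {Q : Matrix (Fin n) (Fin n) ℝ} {R : Matrix (Fin d) (Fin d) ℝ} {C σ ν ρ γ ε : ℝ}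

/-- In `ℝ≥0∞` a zero factor would hide an infinite one, since 0 · ∞ = 0; here every factor is
nonzero, so a finite product has finite factors. -/
lemma transient_ne_top_of_gapBound_ne_top [Nonempty (Fin n)]
    (h1 : 0 < C * σ ^ 2 * d * (ℓ : ℝ) ^ 5 * Gam A B Q R ^ 15)
    (h2 : 0 < costCondSq Q R * (1 + 1 / ν) ^ 2 * ε ^ 2) (hγ : 0 ≤ γ) (hγ1 : γ < 1)
    (h : gapBound C A B Q R σ ρ γ ε ν ℓ ≠ ∞) :
    transient A ρ ≠ ∞ ∧ transient (closedLoop A B Q R) γ ≠ ∞ := by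
  have hγ2 : 0 < 1 - γ ^ 2 := by nlinarith
  have n1 : ENNReal.ofReal (C * σ ^ 2 * d * (ℓ : ℝ) ^ 5 * Gam A B Q R ^ 15) ≠ 0 :=
    (ENNReal.ofReal_pos.2 h1).ne'
  have n2 : ENNReal.ofReal (costCondSq Q R * (1 + 1 / ν) ^ 2 * ε ^ 2) ≠ 0 :=
    (ENNReal.ofReal_pos.2 h2).ne'
  have nA : transient A ρ ≠ 0 := (zero_lt_one.trans_le one_le_transient).ne'
  have nL : transient (closedLoop A B Q R) γ ≠ 0 := (zero_lt_one.trans_le one_le_transient).ne'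
  have nβ : betaConst A ρ ε ≠ 0 := (zero_lt_one.trans_le (le_max_left _ _)).ne'
  have nd : ENNReal.ofReal (1 - γ ^ 2) ≠ 0 := (ENNReal.ofReal_pos.2 hγ2).ne'
  have nT : transient (closedLoop A B Q R) γ ^ 2 / ENNReal.ofReal (1 - γ ^ 2) ≠ 0 :=
    ENNReal.div_ne_zero.2 ⟨pow_ne_zero _ nL, ENNReal.ofReal_ne_top⟩
  have nAp := pow_ne_zero 6 nA
  have nβp := pow_ne_zero (4 * (ℓ - 1)) nβ
  unfold gapBound at h
  generalize ENNReal.ofReal (costCondSq Q R * (1 + 1 / ν) ^ 2 * ε ^ 2) = w at h n2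
  constructor
  · intro htop
    apply h
    rw [htop]
    simp [ENNReal.mul_top, ENNReal.top_mul, n1, n2, nβp, nT]
  · intro htop
    apply h
    rw [htop]
    simp [ENNReal.mul_top, ENNReal.top_mul, ENNReal.top_div, n1, n2, nβp, nAp]

lemma betaConst_eq_ofReal (hA : transient A ρ ≠ ∞) (hρ : 0 ≤ ρ) (hε : 0 ≤ ε) :
    betaConst A ρ ε = ENNReal.ofReal (max 1 (ε * (transient A ρ).toReal + ρ)) := by
  rw [betaConst, (ENNReal.ofReal_mono).map_max, ENNReal.ofReal_one,
    ENNReal.ofReal_add (by positivity) hρ, ENNReal.ofReal_mul hε, ENNReal.ofReal_toReal hA]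

lemma gapBound_eq_ofReal (hA : transient A ρ ≠ ∞)
    (hL : transient (closedLoop A B Q R) γ ≠ ∞) (hρ : 0 ≤ ρ) (hε : 0 ≤ ε) (hγ2 : 0 < 1 - γ ^ 2)
    (h1 : 0 ≤ C * σ ^ 2 * d * (ℓ : ℝ) ^ 5 * Gam A B Q R ^ 15) :
    gapBound C A B Q R σ ρ γ ε ν ℓ = ENNReal.ofReal
      (C * σ ^ 2 * d * (ℓ : ℝ) ^ 5 * Gam A B Q R ^ 15 * (transient A ρ).toReal ^ 6 *
        max 1 (ε * (transient A ρ).toReal + ρ) ^ (4 * (ℓ - 1)) *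
        ((transient (closedLoop A B Q R) γ).toReal ^ 2 / (1 - γ ^ 2)) *
        (costCondSq Q R * (1 + 1 / ν) ^ 2 * ε ^ 2)) := by
  have hβ : 0 ≤ max 1 (ε * (transient A ρ).toReal + ρ) := zero_le_one.trans (le_max_left _ _)
  have hτ := ENNReal.toReal_nonneg (a := transient A ρ)
  have hT : 0 ≤ (transient (closedLoop A B Q R) γ).toReal ^ 2 / (1 - γ ^ 2) := by positivity
  rw [gapBound, betaConst_eq_ofReal hA hρ hε]
  generalize C * σ ^ 2 * d * (ℓ : ℝ) ^ 5 * Gam A B Q R ^ 15 = c at h1 ⊢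
  generalize costCondSq Q R * (1 + 1 / ν) ^ 2 * ε ^ 2 = e
  rw [ENNReal.ofReal_mul (by positivity), ENNReal.ofReal_mul (by positivity),
    ENNReal.ofReal_mul (by positivity), ENNReal.ofReal_mul h1, ENNReal.ofReal_pow hβ,
    ENNReal.ofReal_pow hτ, ENNReal.ofReal_div_of_pos hγ2, ENNReal.ofReal_pow ENNReal.toReal_nonneg,
    ENNReal.ofReal_toReal hA, ENNReal.ofReal_toReal hL]

lemma controlBounds_of_isControllable [Nonempty (Fin n)] {Γ : ℝ} (hctrl : IsControllable A B ℓ ν)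
    (hν : 0 < ν) (hℓ : 1 ≤ ℓ) (hA : transient A ρ ≠ ∞) (hρ : 0 ≤ ρ) (hε : 0 ≤ ε) (hΓ : 1 ≤ Γ)
    (hAΓ : ‖A‖ ≤ Γ) (hBΓ : ‖B‖ ≤ Γ) :
    ControlBounds A B ℓ ν
      ((transient A ρ).toReal * max 1 (ε * (transient A ρ).toReal + ρ) ^ (ℓ - 1)) Γ := by
  set τ := (transient A ρ).toReal
  set β := max 1 (ε * τ + ρ)
  have hτ : 1 ≤ τ := one_le_transient_toReal hA
  have hβ : 1 ≤ β := le_max_left _ _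
  have hρβ : ρ ≤ β := le_trans (by have : 0 ≤ ε * τ := by positivity
                                   linarith) (le_max_right _ _)
  exact
    { ctrl := hctrl.mul_vnorm_le
      ν_pos := hν
      one_le_ℓ := hℓ
      one_le_α := one_le_mul_of_one_le_of_one_le hτ (one_le_pow₀ hβ)
      norm_pow_le := fun i hi => by
        refine (norm_pow_le_transient hA hρ i).trans ?_
        gcongr
        exact (pow_le_pow_left₀ hρ hρβ i).trans (pow_le_pow_right₀ hβ (by omega))
      one_le_Γ := hΓ
      norm_A_le := hAΓ
      norm_B_le := hBΓ }

end Unpacking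

end LQR

theorem theorem2 :
    ∃ C : ℝ, 0 < C ∧
      ∀ (n d ℓ : ℕ) (A Ahat : Matrix (Fin n) (Fin n) ℝ) (B Bhat : Matrix (Fin n) (Fin d) ℝ)
        (Q : Matrix (Fin n) (Fin n) ℝ) (R : Matrix (Fin d) (Fin d) ℝ) (σ ν ρ γ ε : ℝ),
        d ≤ n → 1 ≤ ℓ →
        Q.PosDef → R.PosDef → 1 ≤ LQR.sigmaMin R →
        0 < ν → LQR.IsControllable A B ℓ ν →
        LQR.specRadius A ≤ ρ →
        LQR.specRadius (LQR.closedLoop A B Q R) ≤ γ → γ < 1 →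
        0 < ε → ‖Ahat - A‖ ≤ ε → ‖Bhat - B‖ ≤ ε →
        (∃! P, LQR.IsDareSolution A B Q R P) ∧
          (LQR.gapBound C A B Q R σ ρ γ ε ν ℓ < ENNReal.ofReal (σ ^ 2) →
            (∃! P, LQR.IsDareSolution Ahat Bhat Q R P) ∧
              ∃ Jhat Jstar : ℝ,
                LQR.IsCost A B Q R σ (LQR.gain Ahat Bhat Q R) Jhat ∧
                LQR.IsCost A B Q R σ (LQR.gain A B Q R) Jstar ∧
                Jhat - Jstar ≤ (LQR.gapBound C A B Q R σ ρ γ ε ν ℓ).toReal) := by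
  refine ⟨3000000, by norm_num, ?_⟩
  intro n d ℓ A Ahat B Bhat Q R σ ν ρ γ ε hdn hℓ hQ hR hR1 hν hctrl hρ hγ hγ1 hε hA hB
  have hex := hctrl.existsUnique_dare hν hQ hR
  refine ⟨hex, fun hgap => ?_⟩
  have hd := LQR.nonempty_of_one_le_sigmaMin hR1
  have hd0 : 0 < d := Fin.pos_iff_nonempty.2 hd
  have hn : Nonempty (Fin n) := Fin.pos_iff_nonempty.1 (hd0.trans_le hdn)
  have hρ0 : 0 ≤ ρ := LQR.specRadius_nonneg.trans hρ
  have hγ0 : 0 ≤ γ := LQR.specRadius_nonneg.trans hγ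
  have hγ2 : 0 < 1 - γ ^ 2 := by nlinarith
  have hσ : 0 < σ ^ 2 := ENNReal.ofReal_pos.1 (bot_le.trans_lt hgap)
  have hcost := LQR.costBounds_of_posDef hQ hR hR1
  have hκ : 1 ≤ LQR.costCond Q R := Real.one_le_sqrt.1 hcost.one_le_s
  have hκ2 : √(LQR.costCond Q R) ^ 4 = LQR.costCondSq Q R := by
    rw [← LQR.costCond_sq, show 4 = 2 * 2 from rfl, pow_mul, Real.sq_sqrt (by linarith)]
  have hκ0 : 0 < LQR.costCondSq Q R := by rw [← LQR.costCond_sq]; positivity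
  have hP : LQR.IsDareSolution A B Q R (LQR.dare A B Q R) := Classical.epsilon_spec hex.exists
  set Γ := LQR.Gam A B Q R with hΓ
  have hΓA : 1 + ‖A‖ ≤ Γ := by
    rw [hΓ, LQR.Gam]; gcongr; exact (le_max_left _ _).trans (le_max_left _ _)
  have hΓB : 1 + ‖B‖ ≤ Γ := by
    rw [hΓ, LQR.Gam]; gcongr; exact (le_max_right _ _).trans (le_max_left _ _)
  have hΓP : 1 + ‖LQR.dare A B Q R‖ ≤ Γ := by
    rw [hΓ, LQR.Gam]; gcongr; exact (le_max_left _ _).trans (le_max_right _ _)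
  have hΓK : 1 + ‖LQR.gain A B Q R‖ ≤ Γ := by
    rw [hΓ, LQR.Gam]; gcongr; exact (le_max_right _ _).trans (le_max_right _ _)
  have hΓ1 : 1 ≤ Γ := by linarith [norm_nonneg A]
  have hℓ0 : (1 : ℝ) ≤ ℓ := by exact_mod_cast hℓ
  have hd1 : (1 : ℝ) ≤ d := by exact_mod_cast hd0
  have hpos1 : 0 < 3000000 * σ ^ 2 * d * (ℓ : ℝ) ^ 5 * Γ ^ 15 := by positivity
  have hpos2 : 0 < LQR.costCondSq Q R * (1 + 1 / ν) ^ 2 * ε ^ 2 := by positivity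
  obtain ⟨htA, htL⟩ :=
    LQR.transient_ne_top_of_gapBound_ne_top hpos1 hpos2 hγ0 hγ1 hgap.ne_top
  rw [LQR.gapBound_eq_ofReal htA htL hρ0 hε.le hγ2 hpos1.le] at hgap ⊢
  have hctrlB := LQR.controlBounds_of_isControllable hctrl hν hℓ htA hρ0 hε.le hΓ1
    (by linarith) (by linarith : ‖B‖ ≤ Γ)
  have hτA := LQR.one_le_transient_toReal htA
  have hτL := LQR.one_le_transient_toReal htL
  have hLpow := LQR.norm_pow_le_transient htL hγ0
  set τ := (LQR.transient A ρ).toReal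
  set τL := (LQR.transient (LQR.closedLoop A B Q R) γ).toReal
  set β := max 1 (ε * τ + ρ)
  have hβ : 1 ≤ β := le_max_left _ _
  set T := τL ^ 2 / (1 - γ ^ 2) with hT
  have hT0 : 0 ≤ T := by positivity
  set G := 3000000 * σ ^ 2 * d * (ℓ : ℝ) ^ 5 * Γ ^ 15 * τ ^ 6 * β ^ (4 * (ℓ - 1)) * T *
    (LQR.costCondSq Q R * (1 + 1 / ν) ^ 2 * ε ^ 2) with hG
  have hG0 : 0 ≤ G := by positivity
  have hGσ : G < σ ^ 2 := (ENNReal.ofReal_lt_ofReal_iff hσ).1 hgap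
  rw [ENNReal.toReal_ofReal hG0]
  -- The value dominates the first stage cost, so Q ≤ P.
  have hq : LQR.sigmaMin Q ≤ Γ := by
    obtain ⟨i⟩ := hn
    have h1 := LQR.sigmaMin_mul_vnorm_sq_le_quad hQ (Pi.single i 1)
    have h2 := LQR.quad_le_norm (LQR.dare A B Q R) (Pi.single i 1)
    have h3 := LQR.quad_closedLoop_add hP.eq_closedLoop
      (LQR.R_mul_greedyGain hR hP.posSemidef) (Pi.single i 1)
    have h4 := LQR.quad_nonneg hP.posSemidef
      ((A + B * LQR.greedyGain A B R (LQR.dare A B Q R)) *ᵥ Pi.single i 1)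
    have h5 := LQR.quad_nonneg hR.posSemidef
      (LQR.greedyGain A B R (LQR.dare A B Q R) *ᵥ Pi.single i 1)
    rw [LQR.stageCost_eq] at h3
    simp only [LQR.vnorm_single, one_pow, mul_one] at h1 h2
    linarith
  set E := Γ ^ 15 * √(LQR.costCond Q R) ^ 4 *
    ((1 + 1 / ν) * (ℓ : ℝ) ^ 2 * (τ * β ^ (ℓ - 1)) ^ 2) ^ 2 * T * ε ^ 2 with hE
  -- With α = τ β^(ℓ-1), E contains ℓ⁴ τ⁴ β^(4(ℓ-1)); the stated bound has a factor ℓ τ² ≥ 1 to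
  -- spare.
  have hEG : 3000000 * σ ^ 2 * d * E ≤ G := by
    have h1 : (1 : ℝ) ≤ ℓ * τ ^ 2 := one_le_mul_of_one_le_of_one_le hℓ0 (one_le_pow₀ hτA)
    have h2 : G = 3000000 * σ ^ 2 * d * E * (ℓ * τ ^ 2) := by
      rw [hG, hE, hκ2, show 4 * (ℓ - 1) = (ℓ - 1) * 4 by ring, pow_mul]
      ring
    have hE0 : 0 ≤ E := by positivity
    rw [h2]
    exact le_mul_of_one_le_right (by positivity) h1
  -- The bound being below σ² is the smallness condition, once σ² > 0 is cancelled and d ≥ 1 is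
  -- used.
  have hsmall : 3000000 * E ≤ 1 := by
    have hE0 : 0 ≤ E := by positivity
    have h1 : σ ^ 2 * (3000000 * E) ≤ σ ^ 2 * 1 :=
      calc σ ^ 2 * (3000000 * E) ≤ σ ^ 2 * (3000000 * E) * d :=
            le_mul_of_one_le_right (by positivity) hd1
        _ = 3000000 * σ ^ 2 * d * E := by ring
        _ ≤ σ ^ 2 * 1 := by linarith
    exact le_of_mul_le_mul_left h1 hσ
  obtain ⟨hex', hJ⟩ := hP.gap_le (σ := σ) hctrlB hcost (by linarith) hΓK hq hLpow hτL hγ0 hγ1 hT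
    hε.le hA hB hsmall
  obtain ⟨Jhat, Jstar, h1, h2, h3⟩ := hJ _ (Classical.epsilon_spec hex'.exists)
  exact ⟨hex', Jhat, Jstar, h1, h2, h3.trans hEG⟩
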